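/- All graphs are finite and simple. A graph $G$ is \emph{$H$-free} if no induced subgraph of $G$ is isomorphic to $H$. A \emph{partitioned probe $H$-free graph} is a triple $(G,P,N)$, where $G=(V,E)$ is a graph, $V$ is the disjoint union of a set $P$ of probes and a set $N$ of non-probes, $N$ is independent in $G$, and there exists a set $F\subseteq\binom{N}{2}$ such that the graph $G+F=(V,E\cup F)$ is $H$-free. Let $P_3+sP_1$ denote the disjoint union of a path on three vertices and $s$ isolated vertices. \textbf{Theorem.} For every fixed integer $s\ge 0$, \textsc{3-Colouring} is polynomial-time solvable on partitioned probe $(P_3+sP_1)$-free graphs. That is, for every $s\geq 0$ there are an algorithm and a polynomial $q$ such that, for every partitioned probe $(P_3+sP_1)$-free graph $(G,P,N)$, the algorithm, given $G$, $P$ and $N$ (but not a set $F$), decides correctly and within $q(|V(G)|)$ steps whether the vertices of $G$ can be coloured with three colours such that adjacent vertices receive different colours. (Algorithms are programs for a random access machine with unit-cost addition and subtraction and without multiplication; the graph is given by its adjacency matrix, and $P$ and $N$ by their indicator vectors.) -/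

import Mathlib

/-! ## Partitioned probe `H`-free graphs -/

/-- `G` is `H`-free: no induced subgraph of `G` is isomorphic to `H`. -/
def HFree {V W : Type} (H : SimpleGraph W) (G : SimpleGraph V) : Prop :=
  ¬ H.IsIndContained G

/-- `(G, P, N)` is a partitioned probe `H`-free graph: the vertex set is partitioned into the set
`P` of probes and the set `N` of non-probes, `N` is independent in `G`, and there is a set `F` of
unordered pairs of distinct vertices of `N` such that `G + F` is `H`-free. -/
def IsPartitionedProbeFree {V W : Type} (H : SimpleGraph W) (G : SimpleGraph V)
    (P N : Set V) : Prop :=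
  P ∪ N = Set.univ ∧ Disjoint P N ∧ G.IsIndepSet N ∧
    ∃ F : Set (Sym2 V), (∀ e ∈ F, ¬ e.IsDiag ∧ ∀ v ∈ e, v ∈ N) ∧
      HFree H (G ⊔ SimpleGraph.fromEdgeSet F)

/-- The graph `P₃ + sP₁`: the disjoint union of a path on three vertices and `s` isolated
vertices. -/
def pathThreePlusIsolated (s : ℕ) : SimpleGraph (Fin 3 ⊕ Fin s) :=
  SimpleGraph.sum (SimpleGraph.pathGraph 3) (⊥ : SimpleGraph (Fin s))

/-! ## Random access machines with a step count

Programs of a random access machine with structured control flow. The memory consists of registers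
and of arrays, numbered by `ℕ` (a program mentions finitely many of them), all holding natural
numbers. The arithmetic is addition and truncated subtraction. There is no multiplication, so after
`t` steps every number in memory has at most `O(t)` bits more than the input numbers, and unit-cost
time is polynomially related to the running time of a multitape Turing machine. -/

namespace RAM

/-- The memory: register `r` holds `reg r`, and cell `i` of array `k` holds `arr k i`. -/
@[ext]
structure State where
  reg : ℕ → ℕ
  arr : ℕ → ℕ → ℕ

/-- Write `v` into register `r`. -/
def State.setReg (σ : State) (r v : ℕ) : State :=
  { σ with reg := Function.update σ.reg r v }

/-- Write `v` into cell `i` of array `k`. -/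
def State.setArr (σ : State) (k i v : ℕ) : State :=
  { σ with arr := Function.update σ.arr k (Function.update (σ.arr k) i v) }

/-- Arithmetic expressions. -/
inductive Exp where
  | const (c : ℕ)
  | reg (r : ℕ)
  | read (k : ℕ) (e : Exp)
  | add (e f : Exp)
  | sub (e f : Exp)

/-- The value of an expression; `sub` is truncated subtraction. -/
def Exp.eval (σ : State) : Exp → ℕ
  | .const c => c
  | .reg r => σ.reg r
  | .read k e => σ.arr k (e.eval σ)
  | .add e f => e.eval σ + f.eval σ
  | .sub e f => e.eval σ - f.eval σ

/-- The number of steps used to evaluate an expression: one for each operation in it. -/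
def Exp.cost : Exp → ℕ
  | .const _ => 1
  | .reg _ => 1
  | .read _ e => e.cost + 1
  | .add e f => e.cost + f.cost + 1
  | .sub e f => e.cost + f.cost + 1

/-- Programs. A test succeeds if the value of its expression is nonzero. -/
inductive Prog where
  | skip
  | assign (r : ℕ) (e : Exp)
  | write (k : ℕ) (i e : Exp)
  | seq (p q : Prog)
  | ite (e : Exp) (p q : Prog)
  | loop (e : Exp) (p : Prog)

/-- `Runs p σ t τ`: started in memory `σ`, the program `p` halts after exactly `t` steps in
memory `τ`. -/
inductive Runs : Prog → State → ℕ → State → Prop where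
  | skip (σ : State) : Runs .skip σ 1 σ
  | assign (r : ℕ) (e : Exp) (σ : State) :
      Runs (.assign r e) σ (e.cost + 1) (σ.setReg r (e.eval σ))
  | write (k : ℕ) (i e : Exp) (σ : State) :
      Runs (.write k i e) σ (i.cost + e.cost + 1) (σ.setArr k (i.eval σ) (e.eval σ))
  | seq {p q : Prog} {σ τ ρ : State} {t u : ℕ} :
      Runs p σ t τ → Runs q τ u ρ → Runs (.seq p q) σ (t + u) ρ
  | ite_true {e : Exp} {p q : Prog} {σ τ : State} {t : ℕ} :
      e.eval σ ≠ 0 → Runs p σ t τ → Runs (.ite e p q) σ (e.cost + 1 + t) τ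
  | ite_false {e : Exp} {p q : Prog} {σ τ : State} {t : ℕ} :
      e.eval σ = 0 → Runs q σ t τ → Runs (.ite e p q) σ (e.cost + 1 + t) τ
  | loop_done {e : Exp} {p : Prog} {σ : State} :
      e.eval σ = 0 → Runs (.loop e p) σ (e.cost + 1) σ
  | loop_step {e : Exp} {p : Prog} {σ τ ρ : State} {t u : ℕ} :
      e.eval σ ≠ 0 → Runs p σ t τ → Runs (.loop e p) τ u ρ →
        Runs (.loop e p) σ (e.cost + 1 + t + u) ρ

/-- The machine is deterministic: a program has at most one halting run from a given memory. -/
theorem Runs.det {p : Prog} {σ τ τ' : State} {t t' : ℕ}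
    (h : Runs p σ t τ) (h' : Runs p σ t' τ') : t = t' ∧ τ = τ' := by
  induction h generalizing t' τ' with
  | skip σ => cases h'; exact ⟨rfl, rfl⟩
  | assign r e σ => cases h'; exact ⟨rfl, rfl⟩
  | write k i e σ => cases h'; exact ⟨rfl, rfl⟩
  | seq _ _ ih₁ ih₂ =>
    cases h' with
    | seq a b =>
      obtain ⟨rfl, rfl⟩ := ih₁ a
      obtain ⟨rfl, rfl⟩ := ih₂ b
      exact ⟨rfl, rfl⟩
  | ite_true he _ ih =>
    cases h' with
    | ite_true _ a => obtain ⟨rfl, rfl⟩ := ih a; exact ⟨rfl, rfl⟩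
    | ite_false he' _ => exact absurd he' he
  | ite_false he _ ih =>
    cases h' with
    | ite_true he' _ => exact absurd he he'
    | ite_false _ a => obtain ⟨rfl, rfl⟩ := ih a; exact ⟨rfl, rfl⟩
  | loop_done he =>
    cases h' with
    | loop_done _ => exact ⟨rfl, rfl⟩
    | loop_step he' _ _ => exact absurd he he'
  | loop_step he _ _ ih₁ ih₂ =>
    cases h' with
    | loop_done he' => exact absurd he' he
    | loop_step _ a b =>
      obtain ⟨rfl, rfl⟩ := ih₁ a
      obtain ⟨rfl, rfl⟩ := ih₂ b
      exact ⟨rfl, rfl⟩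

end RAM

/-! ## Polynomial-time solvability on a class of partitioned graphs -/

/-- A finite graph together with two sets `P`, `N` of vertices; the vertices are `0, …, n - 1`. -/
structure PartitionedGraph where
  n : ℕ
  graph : SimpleGraph (Fin n)
  P : Set (Fin n)
  N : Set (Fin n)

open Classical in
/-- The input memory for `(G, P, N)`: register `0` holds the number `n` of vertices, array `0` holds
the adjacency matrix row by row, arrays `1` and `2` hold the indicator vectors of `P` and of `N`,
and everything else is `0`. -/
noncomputable def PartitionedGraph.input (x : PartitionedGraph) : RAM.State where
  reg r := if r = 0 then x.n else 0
  arr k i :=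
    if k = 0 then
      if ∃ u v : Fin x.n, i = u.val * x.n + v.val ∧ x.graph.Adj u v then 1 else 0
    else if k = 1 then
      if ∃ u : Fin x.n, i = u.val ∧ u ∈ x.P then 1 else 0
    else if k = 2 then
      if ∃ u : Fin x.n, i = u.val ∧ u ∈ x.N then 1 else 0
    else 0

/-- The decision problem `Yes` is polynomial-time solvable on the class `C`: there are one program
and one polynomial such that on every input from `C` the program halts, after a number of steps
bounded by the polynomial in the number of vertices, with `1` in register `0` on yes-instances and
`0` in register `0` on no-instances. -/
def PolyTimeSolvableOn (C Yes : PartitionedGraph → Prop) : Prop :=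
  ∃ (p : RAM.Prog) (q : Polynomial ℕ), ∀ x : PartitionedGraph, C x →
    ∃ (t : ℕ) (τ : RAM.State), RAM.Runs p x.input t τ ∧ t ≤ q.eval x.n ∧
      (Yes x → τ.reg 0 = 1) ∧ (¬ Yes x → τ.reg 0 = 0)

/-! ## Dominating sets in the core of a 3-colourable probe graph -/

/-! A vertex with fewer than three remaining neighbours can be coloured last, so only the core,
where all degrees are at least three, matters. If `G` is 3-colourable, the core has a dominating set
of at most `7 * s + 4` vertices (`exists_dominating`). For fixed `s` all colourings of so few
vertices can be tried in polynomial time. Once a dominating set is coloured, every other core vertex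
has at most two colours left. This is a 2-SAT instance, solved by unit propagation with trials that
never have to be revised later (`Ext.merge`, `good_of_ext`). Conversely, any colouring found on the
core extends to `G` (`colorable_of_goodAfter`).

For the dominating set, let `H = G + F`. Edges at probes are the same in `G` and `H`, so each colour
class of probes is independent in `H`; sample up to `s` vertices from each. Let `W` be the core
non-probes without a sampled neighbour. Two neighbours of `w ∈ W` in one class would form with `w`
an induced `P₃` missing `s` sampled vertices. Hence `w`, of degree at least three, has exactly one
neighbour in each class; `π w` is the one in class `0`. If `w` and `w'` in `W` are adjacent in `H`,
then `π w = π w'`, since otherwise `π w, w, w'` is such a `P₃`. Now fix one induced path `a, v, b`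
with `a`, `b` probes. The vertices missing it contribute at most `s` probes per class and at most
`s` values of `π`, because members of `W` with distinct values are non-adjacent in `H`. These, the
samples, the path and `π v` dominate the core.

For the machine model, programs are written in a language of for-loops whose meaning and polynomial
time bound are justified once (`Cmd.runs_compile`); each command is then matched with a function on
arrays. -/

/-- In a `(P₃ + sP₁)`-free graph an independent set missing an induced `P₃` has fewer than `s`
vertices. -/
theorem HFree.card_lt {V : Type} {s : ℕ} {H : SimpleGraph V}
    (hH : HFree (pathThreePlusIsolated s) H) {a b d : V} (hab : H.Adj a b) (hbd : H.Adj b d)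
    (had : ¬ H.Adj a d) (hne : a ≠ d) (T : Finset V)
    (hT : ∀ t ∈ T, ∀ t' ∈ T, ¬ H.Adj t t')
    (hTa : ∀ t ∈ T, t ≠ a ∧ ¬ H.Adj a t) (hTb : ∀ t ∈ T, t ≠ b ∧ ¬ H.Adj b t)
    (hTd : ∀ t ∈ T, t ≠ d ∧ ¬ H.Adj d t) : T.card < s := by
  by_contra hcard
  push Not at hcard
  obtain ⟨S, hST, hS⟩ := Finset.exists_subset_card_eq hcard
  let e : Fin s ≃ S := (finCongr hS.symm).trans S.equivFin.symm
  have he : ∀ i, (e i : V) ∈ T := fun i => hST (e i).2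
  have hinj : ∀ i j, (e i : V) = e j → i = j := fun i j h => e.injective (Subtype.ext h)
  refine hH ⟨⟨⟨Sum.elim ![a, b, d] (fun i => (e i : V)), ?_⟩, ?_⟩⟩
  · have h1 := hab.ne
    have h2 := hbd.ne
    rintro (i | i) (j | j) h
    · fin_cases i <;> fin_cases j <;> simp_all
    · have := he j
      fin_cases i <;> simp_all
    · have := he i
      fin_cases j <;> simp_all
    · simpa using hinj i j h
  · have h1 := hab.symm
    have h2 := hbd.symm
    have h3 : ¬ H.Adj d a := fun h => had h.symm
    intro i j
    change H.Adj (Sum.elim ![a, b, d] (fun i => (e i : V)) i)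
      (Sum.elim ![a, b, d] (fun i => (e i : V)) j) ↔ _
    rcases i with i | i <;> rcases j with j | j
    · fin_cases i <;> fin_cases j <;>
        simp_all [pathThreePlusIsolated, SimpleGraph.pathGraph_adj]
    · have := he j
      fin_cases i <;> simp_all [pathThreePlusIsolated]
    · have := he i
      have ha := hTa _ this
      have hb := hTb _ this
      have hd := hTd _ this
      fin_cases j <;> simp_all [pathThreePlusIsolated, H.adj_comm (e i : V)]
    · simp [pathThreePlusIsolated, hT _ (he i) _ (he j)]

open Classical in
/-- A 3-colourable partitioned probe `(P₃ + sP₁)`-free graph of minimum degree at least three (here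
the subgraph induced by `C`) has a dominating set of bounded size. -/
theorem exists_dominating {V : Type} [Fintype V] {s : ℕ} {G : SimpleGraph V} {P N : Set V}
    (h : IsPartitionedProbeFree (pathThreePlusIsolated s) G P N) (c : G.Coloring (Fin 3))
    (C : Finset V) (hC : ∀ v ∈ C, 3 ≤ (C.filter (G.Adj v)).card) :
    ∃ D ⊆ C, D.card ≤ 7 * s + 4 ∧ ∀ v ∈ C, v ∈ D ∨ ∃ w ∈ D, G.Adj v w := by
  obtain ⟨hPN, hdisj, hN, F, hF, hH⟩ := h
  set H := G ⊔ SimpleGraph.fromEdgeSet F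
  have hPN' : ∀ v, v ∉ P → v ∈ N := fun v hv => by
    have : v ∈ P ∪ N := hPN ▸ Set.mem_univ v
    exact this.resolve_left hv
  have hNP : ∀ v, v ∈ N → v ∉ P := fun v hv hv' => Set.disjoint_left.1 hdisj hv' hv
  have hGH : ∀ {u v}, G.Adj u v → H.Adj u v := fun h => Or.inl h
  have hadj : ∀ {p v}, p ∈ P → (H.Adj p v ↔ G.Adj p v) := by
    intro p v hp
    refine ⟨?_, hGH⟩
    rintro (h | h)
    · exact h
    · rw [SimpleGraph.fromEdgeSet_adj] at h
      exact absurd hp (hNP _ ((hF _ h.1).2 p (Sym2.mem_mk_left _ _)))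
  have hadj' : ∀ {p v}, p ∈ P → (H.Adj v p ↔ G.Adj v p) := by
    intro p v hp
    rw [H.adj_comm, G.adj_comm, hadj hp]
  have hNadj : ∀ {u v}, u ∈ N → G.Adj u v → v ∈ P := by
    intro u v hu huv
    by_contra hv
    exact hN hu (hPN' v hv) huv.ne huv
  -- an induced path through a vertex all of whose neighbours are probes
  have path : ∀ v ∈ C, (∀ w ∈ C, G.Adj v w → w ∈ P) → ∃ a ∈ C, ∃ b ∈ C, a ∈ P ∧ b ∈ P ∧
      G.Adj v a ∧ G.Adj v b ∧ ¬ G.Adj a b ∧ a ≠ b := by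
    intro v hv hw
    obtain ⟨x, y, z, hx, hy, hz, hxy, hxz, hyz⟩ := Finset.two_lt_card_iff.1 (hC v hv)
    rw [Finset.mem_filter] at hx hy hz
    by_contra! hcon
    have key : ∀ a b, a ∈ C → b ∈ C → G.Adj v a → G.Adj v b → a ≠ b → G.Adj a b := by
      intro a b ha hb hva hvb hab
      by_contra hn
      exact hab (hcon a ha b hb (hw a ha hva) (hw b hb hvb) hva hvb hn)
    -- Otherwise `v, x, y, z` form a `K₄`, which has no 3-colouring.
    have h1 := c.valid hx.2
    have h2 := c.valid hy.2
    have h3 := c.valid hz.2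
    have h4 := c.valid (key x y hx.1 hy.1 hx.2 hy.2 hxy)
    have h5 := c.valid (key x z hx.1 hz.1 hx.2 hz.2 hxz)
    have h6 := c.valid (key y z hy.1 hz.1 hy.2 hz.2 hyz)
    omega
  -- the colour classes of the probes and their samples
  let I : Fin 3 → Finset V := fun j => C.filter (fun p => p ∈ P ∧ c p = j)
  have hI : ∀ {j p}, p ∈ I j ↔ p ∈ C ∧ p ∈ P ∧ c p = j := by simp [I]
  have hIind : ∀ {j p q}, p ∈ I j → q ∈ I j → ¬ H.Adj p q := by
    intro j p q hp hq hpq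
    rw [hI] at hp hq
    exact c.valid ((hadj hp.2.1).1 hpq) (hp.2.2.trans hq.2.2.symm)
  -- A sample smaller than `s` is the whole class, so a vertex that avoids the sample but has a
  -- neighbour in the class certifies a sample of size exactly `s`.
  have hsample : ∀ j, ∃ T ⊆ I j, T.card ≤ s ∧ (T.card = s ∨ T = I j) := by
    intro j
    rcases le_total s (I j).card with hs | hs
    · obtain ⟨T, hT, hTs⟩ := Finset.exists_subset_card_eq hs
      exact ⟨T, hT, hTs.le, Or.inl hTs⟩
    · exact ⟨I j, subset_rfl, hs, Or.inr rfl⟩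
  choose T hTI hTs hTor using hsample
  let W : Finset V := C.filter (fun w => w ∈ N ∧ ∀ j, ∀ t ∈ T j, ¬ G.Adj w t)
  have hW : ∀ {w}, w ∈ W ↔ w ∈ C ∧ w ∈ N ∧ ∀ j, ∀ t ∈ T j, ¬ G.Adj w t := by simp [W]
  have hTmiss : ∀ {w j}, w ∈ W → ∀ t ∈ T j, t ≠ w ∧ ¬ H.Adj w t := by
    intro w j hw t ht
    have htP := (hI.1 (hTI j ht)).2.1
    have hw' := hW.1 hw
    refine ⟨?_, fun h => hw'.2.2 j t ht ((hadj' htP).1 h)⟩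
    rintro rfl
    exact hNP _ hw'.2.1 htP
  have hTfull : ∀ {w j p}, w ∈ W → p ∈ I j → G.Adj w p → (T j).card = s := by
    intro w j p hw hp hwp
    refine (hTor j).resolve_right fun hT => ?_
    exact (hW.1 hw).2.2 j p (hT ▸ hp) hwp
  have hTp : ∀ {w j p}, w ∈ W → p ∈ I j → G.Adj w p → ∀ t ∈ T j, t ≠ p ∧ ¬ H.Adj p t := by
    intro w j p hw hp hwp t ht
    refine ⟨?_, hIind hp (hTI j ht)⟩
    rintro rfl
    exact (hW.1 hw).2.2 j t ht hwp
  have hone : ∀ {w j p q}, w ∈ W → p ∈ I j → q ∈ I j → G.Adj w p → G.Adj w q → p = q := by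
    intro w j p q hw hp hq hwp hwq
    by_contra hpq
    have := hH.card_lt (hGH hwp.symm) (hGH hwq) (hIind hp hq) hpq (T j)
      (fun t ht t' ht' => hIind (hTI j ht) (hTI j ht'))
      (hTp hw hp hwp) (hTmiss hw) (hTp hw hq hwq)
    exact this.ne (hTfull hw hp hwp)
  have hex : ∀ w ∈ W, ∃ p ∈ I 0, G.Adj w p := by
    intro w hw
    have hw' := hW.1 hw
    by_contra! hcon
    -- All neighbours of the non-probe `w` are probes. Without class `0` there would be at most two
    -- of them in the core, one per remaining class.
    have hsub : C.filter (G.Adj w) ⊆ (I 1).filter (G.Adj w) ∪ (I 2).filter (G.Adj w) := by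
      intro p hp
      rw [Finset.mem_filter] at hp
      have hpP := hNadj hw'.2.1 hp.2
      have h0 : c p ≠ 0 := fun h0 => hcon p (hI.2 ⟨hp.1, hpP, h0⟩) hp.2
      have h12 : c p = 1 ∨ c p = 2 := by omega
      exact Finset.mem_union.2 (h12.imp
        (fun h => Finset.mem_filter.2 ⟨hI.2 ⟨hp.1, hpP, h⟩, hp.2⟩)
        (fun h => Finset.mem_filter.2 ⟨hI.2 ⟨hp.1, hpP, h⟩, hp.2⟩))
    have hle : ∀ j, ((I j).filter (G.Adj w)).card ≤ 1 := by
      intro j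
      rw [Finset.card_le_one]
      intro p hp q hq
      rw [Finset.mem_filter] at hp hq
      exact hone hw hp.1 hq.1 hp.2 hq.2
    have h1 := (Finset.card_le_card hsub).trans (Finset.card_union_le _ _)
    have h2 := hC w hw'.1
    have h3 := hle 1
    have h4 := hle 2
    omega
  choose! π hπI hπ using hex
  -- The edge `w w'` may belong to `F`; the induced path `π w, w, w'` of `H` would miss the full
  -- sample `T 0`.
  have hsame : ∀ w ∈ W, ∀ w' ∈ W, H.Adj w w' → π w = π w' := by
    intro w hw w' hw' hww
    by_contra hne
    have hP := (hI.1 (hπI w hw)).2.1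
    have hna : ¬ H.Adj (π w) w' := by
      rw [hadj hP]
      intro hadj
      exact hne (hone hw' (hπI w hw) (hπI w' hw') hadj.symm (hπ w' hw'))
    have hne' : π w ≠ w' := by
      rintro h
      exact hNP w' (hW.1 hw').2.1 (h ▸ hP)
    have := hH.card_lt (hGH (hπ w hw).symm) hww hna hne' (T 0)
      (fun t ht t' ht' => hIind (hTI 0 ht) (hTI 0 ht'))
      (hTp hw (hπI w hw) (hπ w hw)) (hTmiss hw) (hTmiss hw')
    exact this.ne (hTfull hw (hπI w hw) (hπ w hw))
  rcases C.eq_empty_or_nonempty with rfl | ⟨v₀, hv₀⟩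
  · exact ⟨∅, subset_rfl, by simp, by simp⟩
  -- the centre of the path, undominated by the samples if possible
  obtain ⟨v, hv, hvP, hvW⟩ : ∃ v ∈ C, (∀ w ∈ C, G.Adj v w → w ∈ P) ∧ (W.Nonempty → v ∈ W) := by
    rcases W.eq_empty_or_nonempty with hW0 | ⟨v, hv⟩
    · have hnW : ¬ W.Nonempty := by simp [hW0]
      by_cases hU : ∃ u ∈ C, u ∈ N
      · obtain ⟨u, hu, huN⟩ := hU
        exact ⟨u, hu, fun w _ hw => hNadj huN hw, fun h => absurd h hnW⟩
      · push Not at hU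
        refine ⟨v₀, hv₀, fun w hw _ => ?_, fun h => absurd h hnW⟩
        by_contra hwP
        exact hU w hw (hPN' w hwP)
    · exact ⟨v, (hW.1 hv).1, fun w _ hw => hNadj (hW.1 hv).2.1 hw, fun _ => hv⟩
  obtain ⟨a, ha, b, hb, haP, hbP, hva, hvb, hab, hne⟩ := path v hv hvP
  have hab' : ¬ H.Adj a b := by rwa [hadj haP]
  let R : Fin 3 → Finset V := fun j => (I j).filter
    (fun p => (p ≠ a ∧ ¬ G.Adj a p) ∧ (p ≠ v ∧ ¬ G.Adj v p) ∧ (p ≠ b ∧ ¬ G.Adj b p))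
  have hR : ∀ j, (R j).card ≤ s := by
    intro j
    have hmem : ∀ t ∈ R j, t ∈ I j ∧ (t ≠ a ∧ ¬ G.Adj a t) ∧ (t ≠ v ∧ ¬ G.Adj v t) ∧
      (t ≠ b ∧ ¬ G.Adj b t) := fun t ht => by simpa [R] using ht
    refine (hH.card_lt (hGH hva.symm) (hGH hvb) hab' hne (R j)
      (fun t ht t' ht' => hIind (hmem t ht).1 (hmem t' ht').1) (fun t ht => ?_) (fun t ht => ?_)
      (fun t ht => ?_)).le <;>
    · have htP := (hI.1 (hmem t ht).1).2.1
      rw [hadj' htP]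
      have := hmem t ht
      tauto
  let W' : Finset V := W.filter
    (fun w => w ≠ v ∧ ¬ H.Adj v w ∧ ¬ G.Adj a w ∧ ¬ G.Adj b w)
  have hW' : ∀ {w}, w ∈ W' ↔ w ∈ W ∧ w ≠ v ∧ ¬ H.Adj v w ∧ ¬ G.Adj a w ∧ ¬ G.Adj b w := by
    simp [W']
  have hQ : (W'.image π).card ≤ s := by
    -- One representative per value of `π`. By `hsame` these are independent in `H`, and they miss
    -- the path `a, v, b`.
    obtain ⟨S, hS, hSim, hScard⟩ : ∃ S ⊆ W', S.image π = W'.image π ∧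
        S.card = (W'.image π).card := by
      obtain ⟨S, hS, hSi, hSim⟩ := Finset.exists_subset_injOn_image_eq_of_surjOn
        (f := π) W' (W'.image π) (by rw [Finset.coe_image]; exact Set.surjOn_image π _)
      exact ⟨S, hS, hSim, by rw [← hSim, Finset.card_image_of_injOn hSi]⟩
    rw [← hScard]
    have hinj : Set.InjOn π S := Finset.card_image_iff.1 (by rw [hSim, hScard])
    refine (hH.card_lt (hGH hva.symm) (hGH hvb) hab' hne S (fun t ht t' ht' htt => ?_)
      (fun t ht => ?_) (fun t ht => ?_) (fun t ht => ?_)).le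
    · have := hsame t (hW'.1 (hS ht)).1 t' (hW'.1 (hS ht')).1 htt
      exact htt.ne (hinj ht ht' this)
    all_goals
      have h1 := hW'.1 (hS ht)
      have h2 := hNP t (hW.1 h1.1).2.1
    · rw [hadj haP]
      exact ⟨fun h => h2 (h ▸ haP), h1.2.2.2.1⟩
    · exact ⟨h1.2.1, h1.2.2.1⟩
    · rw [hadj hbP]
      exact ⟨fun h => h2 (h ▸ hbP), h1.2.2.2.2⟩
  -- The sizes are `3s + 3s + s + 4`. Intersecting with `C` is needed because `π v` is an arbitrary
  -- vertex when `v ∉ W`.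
  refine ⟨C ∩ ((T 0 ∪ T 1 ∪ T 2) ∪ (R 0 ∪ R 1 ∪ R 2) ∪ W'.image π ∪ {a, v, b, π v}),
    Finset.inter_subset_left, ?_, ?_⟩
  · refine (Finset.card_le_card Finset.inter_subset_right).trans ?_
    have h4 : ({a, v, b, π v} : Finset V).card ≤ 4 := Finset.card_le_four
    have hT' : (T 0 ∪ T 1 ∪ T 2).card ≤ s + s + s :=
      (Finset.card_union_le _ _).trans (add_le_add ((Finset.card_union_le _ _).trans
        (add_le_add (hTs 0) (hTs 1))) (hTs 2))
    have hR' : (R 0 ∪ R 1 ∪ R 2).card ≤ s + s + s :=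
      (Finset.card_union_le _ _).trans (add_le_add ((Finset.card_union_le _ _).trans
        (add_le_add (hR 0) (hR 1))) (hR 2))
    have h1 := Finset.card_union_le (T 0 ∪ T 1 ∪ T 2) (R 0 ∪ R 1 ∪ R 2)
    have h2 := Finset.card_union_le ((T 0 ∪ T 1 ∪ T 2) ∪ (R 0 ∪ R 1 ∪ R 2)) (W'.image π)
    have h3 := Finset.card_union_le ((T 0 ∪ T 1 ∪ T 2) ∪ (R 0 ∪ R 1 ∪ R 2) ∪ W'.image π)
      {a, v, b, π v}
    omega
  · set D := (T 0 ∪ T 1 ∪ T 2) ∪ (R 0 ∪ R 1 ∪ R 2) ∪ W'.image π ∪ {a, v, b, π v} with hD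
    have hDT : ∀ j, ∀ t ∈ T j, t ∈ D := by
      intro j t ht
      simp only [hD, Finset.mem_union]
      left; left; left
      fin_cases j
      · exact Or.inl (Or.inl ht)
      · exact Or.inl (Or.inr ht)
      · exact Or.inr ht
    have hDR : ∀ j, ∀ t ∈ R j, t ∈ D := by
      intro j t ht
      simp only [hD, Finset.mem_union]
      left; left; right
      fin_cases j
      · exact Or.inl (Or.inl ht)
      · exact Or.inl (Or.inr ht)
      · exact Or.inr ht
    have hDW : W'.image π ⊆ D := Finset.subset_union_right.trans Finset.subset_union_left
    have hDa : {a, v, b, π v} ⊆ D := Finset.subset_union_right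
    have haD : a ∈ D := hDa (by simp)
    have hvD : v ∈ D := hDa (by simp)
    have hbD : b ∈ D := hDa (by simp)
    have hπD : π v ∈ D := hDa (by simp)
    clear_value D
    intro w hw
    simp only [Finset.mem_inter]
    by_cases hwP : w ∈ P
    · by_cases hwa : w = a ∨ w = v ∨ w = b
      · left
        rcases hwa with rfl | rfl | rfl
        exacts [⟨hw, haD⟩, ⟨hw, hvD⟩, ⟨hw, hbD⟩]
      by_cases haw : G.Adj a w
      · exact Or.inr ⟨a, ⟨ha, haD⟩, haw.symm⟩
      by_cases hvw : G.Adj v w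
      · exact Or.inr ⟨v, ⟨hv, hvD⟩, hvw.symm⟩
      by_cases hbw : G.Adj b w
      · exact Or.inr ⟨b, ⟨hb, hbD⟩, hbw.symm⟩
      push Not at hwa
      exact Or.inl ⟨hw, hDR (c w) w (Finset.mem_filter.2 ⟨hI.2 ⟨hw, hwP, rfl⟩,
        ⟨hwa.1, haw⟩, ⟨hwa.2.1, hvw⟩, ⟨hwa.2.2, hbw⟩⟩)⟩
    · right
      have hwN := hPN' w hwP
      by_cases hwW : w ∈ W
      · have hπC := (hI.1 (hπI w hwW)).1
        by_cases hwa : G.Adj a w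
        · exact ⟨a, ⟨ha, haD⟩, hwa.symm⟩
        by_cases hwb : G.Adj b w
        · exact ⟨b, ⟨hb, hbD⟩, hwb.symm⟩
        refine ⟨π w, ⟨hπC, ?_⟩, hπ w hwW⟩
        by_cases hwv : w = v
        · rwa [hwv]
        -- An `F`-edge from `v` to `w` does not dominate `w` in `G`, but it gives `π w = π v`; this
        -- is why `v` was taken in `W` and `π v` was added.
        by_cases hvw : H.Adj v w
        · rwa [← hsame v (hvW ⟨w, hwW⟩) w hwW hvw]
        exact hDW (Finset.mem_image_of_mem _ (hW'.2 ⟨hwW, hwv, hvw, hwa, hwb⟩))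
      · have : ∃ j, ∃ t ∈ T j, G.Adj w t := by
          by_contra! hcon
          exact hwW (hW.2 ⟨hw, hwN, hcon⟩)
        obtain ⟨j, t, ht, hwt⟩ := this
        exact ⟨t, ⟨(hI.1 (hTI j ht)).1, hDT j t ht⟩, hwt⟩

/-! ## The algorithm on arrays

A graph on `{0, …, n - 1}` is given by its adjacency relation `A`, a partial colouring by an array
with entries `0` (not coloured), `1`, `2`, `3` (coloured) and `4` (deleted). -/

namespace ThreeCol

/-- Apply `f 0`, `f 1`, …, `f (m - 1)` in turn. -/
def loopN {α : Type} (f : ℕ → α → α) : ℕ → α → α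
  | 0, x => x
  | m + 1, x => f m (loopN f m x)

section Pure

variable (n : ℕ) (A : ℕ → ℕ → Prop)

def Sees (col : ℕ → ℕ) (v a : ℕ) : Prop := ∃ w < n, A v w ∧ col w = a

/-- The bounds exempt uncoloured and deleted vertices from conflicts. -/
def Bad (col : ℕ → ℕ) : Prop :=
  ∃ u < n, ∃ v < n, A u v ∧ col u = col v ∧ 1 ≤ col u ∧ col u ≤ 3

open Classical in
/-- The colour forced upon `v` by two colours in its neighbourhood, or `0`. -/
noncomputable def forced (col : ℕ → ℕ) (v : ℕ) : ℕ :=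
  if Sees n A col v 2 ∧ Sees n A col v 3 then 1
  else if Sees n A col v 1 ∧ Sees n A col v 3 then 2
  else if Sees n A col v 1 ∧ Sees n A col v 2 then 3 else 0

noncomputable def propStep (v : ℕ) (col : ℕ → ℕ) : ℕ → ℕ :=
  if col v = 0 then Function.update col v (forced n A col v) else col

noncomputable def prop (col : ℕ → ℕ) : ℕ → ℕ :=
  loopN (fun _ => loopN (propStep n A) n) n col

def place (v a : ℕ) (col : ℕ → ℕ) : ℕ → ℕ :=
  if col v = 0 then Function.update col v a else col

-- A conflict rejects the colour; otherwise the propagated array is kept for good.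
open Classical in
noncomputable def tryStep (v a : ℕ) (col : ℕ → ℕ) : ℕ → ℕ :=
  if Bad n A (prop n A (place v a col)) then col else prop n A (place v a col)

noncomputable def solve (g : ℕ → ℕ) : ℕ → ℕ :=
  loopN (fun v col => tryStep n A v 3 (tryStep n A v 2 (tryStep n A v 1 col))) n g

def Good (g : ℕ → ℕ) : Prop := ¬ Bad n A (solve n A g) ∧ ∀ v < n, solve n A g v ≠ 0

/-- Some assignment of colours to at most `k` vertices turns `g` into a good array. -/
def GoodAfter : ℕ → (ℕ → ℕ) → Prop
  | 0, g => Good n A g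
  | k + 1, g => GoodAfter k g ∨ ∃ v < n, GoodAfter k (Function.update g v 1) ∨
      GoodAfter k (Function.update g v 2) ∨ GoodAfter k (Function.update g v 3)

open Classical in
noncomputable def coreStep (v : ℕ) (g : ℕ → ℕ) : ℕ → ℕ :=
  if g v = 0 ∧ ((Finset.range n).filter (fun w => A v w ∧ g w = 0)).card < 3 then
    Function.update g v 4 else g

noncomputable def core : ℕ → ℕ := loopN (fun _ => loopN (coreStep n A) n) n (fun _ => 0)

end Pure

/-! ### Fixed points of inflationary passes -/

theorem loopN_induct {α : Type} (f : ℕ → α → α) (m : ℕ) (x : α) (p : ℕ → α → Prop) (h0 : p 0 x)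
    (hs : ∀ i < m, ∀ y, p i y → p (i + 1) (f i y)) : p m (loopN f m x) := by
  induction m with
  | zero => exact h0
  | succ m ih => exact hs m m.lt_succ_self _ (ih fun i hi => hs i (hi.trans m.lt_succ_self))

/-- `col'` keeps all nonzero entries of `col`. -/
def Keeps (col col' : ℕ → ℕ) : Prop := ∀ v, col v ≠ 0 → col' v = col v

theorem Keeps.refl (col : ℕ → ℕ) : Keeps col col := fun _ _ => rfl

theorem Keeps.trans {a b c : ℕ → ℕ} (h : Keeps a b) (h' : Keeps b c) : Keeps a c := by
  intro v hv
  rw [h' v (by rw [h v hv]; exact hv), h v hv]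

theorem Keeps.antisymm {a b : ℕ → ℕ} (h : Keeps a b) (h' : Keeps b a) : a = b := by
  funext v
  by_cases hv : a v = 0
  · by_cases hv' : b v = 0
    · rw [hv, hv']
    · exact h' v hv'
  · exact (h v hv).symm

/-- Iterating a pass of inflationary steps `n` times reaches a common fixed point. -/
theorem loopN_fixed {n : ℕ} {f : ℕ → (ℕ → ℕ) → ℕ → ℕ} (hf : ∀ v col, Keeps col (f v col))
    (hn : ∀ v < n, ∀ col w, n ≤ w → f v col w = col w) (col : ℕ → ℕ) {v : ℕ} (hv : v < n) :
    f v (loopN (fun _ => loopN f n) n col) = loopN (fun _ => loopN f n) n col := by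
  classical
  have hkeep : ∀ m col, Keeps col (loopN f m col) := fun m col =>
    loopN_induct f m col (fun _ y => Keeps col y) (Keeps.refl _) fun i _ y hy => hy.trans (hf i y)
  have houter : ∀ m ≤ n, ∀ col w, n ≤ w → loopN f m col w = col w := fun m hm col w hw =>
    loopN_induct f m col (fun _ y => y w = col w) rfl
      fun i hi y hy => (hn i (hi.trans_le hm) y w hw).trans hy
  have hmid : ∀ col m k, Keeps (loopN f m col) (loopN f (m + k) col) := by
    intro col m k
    induction k with
    | zero => exact Keeps.refl _
    | succ k ih => exact ih.trans (hf _ _)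
  have hfix : ∀ col, loopN f n col = col → ∀ v < n, f v col = col := by
    intro col hcol v hv
    have h1 : ∀ m ≤ n, loopN f m col = col := by
      intro m hm
      obtain ⟨k, rfl⟩ := Nat.exists_eq_add_of_le hm
      have h := hmid col m k
      rw [hcol] at h
      exact h.antisymm (hkeep m col)
    have h2 := h1 (v + 1) hv
    rwa [loopN, h1 v hv.le] at h2
  let z : (ℕ → ℕ) → ℕ := fun col => ((Finset.range n).filter (fun v => col v = 0)).card
  have hdec : ∀ col, loopN f n col ≠ col → z (loopN f n col) < z col := by
    intro col hne
    obtain ⟨w, hw⟩ := Function.ne_iff.1 hne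
    have hw0 : col w = 0 := by
      by_contra h
      exact hw (hkeep n col w h)
    refine Finset.card_lt_card (Finset.ssubset_iff_subset_ne.2 ⟨fun u hu => ?_, fun heq => ?_⟩)
    · simp only [Finset.mem_filter] at hu ⊢
      refine ⟨hu.1, ?_⟩
      by_contra h
      exact h (by rw [← hkeep n col u h, hu.2])
    · have hwn : w < n := by
        by_contra h
        exact hw (houter n le_rfl col w (not_lt.1 h))
      have : w ∈ (Finset.range n).filter (fun v => loopN f n col v = 0) := by
        rw [heq]; simp [hwn, hw0]
      simp only [Finset.mem_filter] at this
      exact hw (this.2.trans hw0.symm)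
  -- Every pass that changes something uses up a zero entry, and there are at most `n` of them.
  have hmain : ∀ m, let y := loopN (fun _ => loopN f n) m col; loopN f n y = y ∨ z y + m ≤ n := by
    intro m
    induction m with
    | zero =>
      right
      exact (Finset.card_filter_le _ _).trans (Finset.card_range n).le
    | succ m ih =>
      simp only [loopN]
      rcases ih with ih | ih
      · left; rw [ih, ih]
      · by_cases h : loopN f n (loopN (fun _ => loopN f n) m col) = loopN (fun _ => loopN f n) m col
        · left; rw [h, h]
        · right
          have := hdec _ h
          omega
  refine hfix _ ?_ v hv
  rcases hmain n with h | h
  · exact h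
  · by_contra hne
    have := hdec _ hne
    omega

/-- `col'` arises from `col` by colouring some vertices. -/
def Grow (col col' : ℕ → ℕ) : Prop := Keeps col col' ∧ ∀ v, col v = 0 → col' v ≤ 3

theorem Grow.refl (col : ℕ → ℕ) : Grow col col := ⟨Keeps.refl _, fun v hv => by omega⟩

theorem Grow.trans {a b c : ℕ → ℕ} (h : Grow a b) (h' : Grow b c) : Grow a c := by
  refine ⟨h.1.trans h'.1, fun v hv => ?_⟩
  by_cases hb : b v = 0
  · exact h'.2 v hb
  · rw [h'.1 v hb]; exact h.2 v hv

variable {n : ℕ} {A : ℕ → ℕ → Prop}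

theorem forced_le (col : ℕ → ℕ) (v : ℕ) : forced n A col v ≤ 3 := by
  unfold forced; split_ifs <;> omega

theorem grow_update {col : ℕ → ℕ} {v a : ℕ} (hv : col v = 0) (ha : a ≤ 3) :
    Grow col (Function.update col v a) := by
  refine ⟨fun w hw => ?_, fun w hw => ?_⟩
  · rw [Function.update_of_ne]; rintro rfl; exact hw hv
  · by_cases h : w = v
    · subst h; simpa using ha
    · rw [Function.update_of_ne h]; omega

theorem grow_propStep (v : ℕ) (col : ℕ → ℕ) : Grow col (propStep n A v col) := by
  unfold propStep
  split_ifs with h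
  · exact grow_update h (forced_le _ _)
  · exact Grow.refl _

theorem grow_prop (col : ℕ → ℕ) : Grow col (prop n A col) :=
  loopN_induct _ n col (fun _ y => Grow col y) (Grow.refl _) fun _ _ y hy =>
    loopN_induct _ n y (fun _ y => Grow col y) hy fun i _ y hy => hy.trans (grow_propStep i y)

theorem grow_place {v a : ℕ} (ha : a ≤ 3) (col : ℕ → ℕ) : Grow col (place v a col) := by
  unfold place
  split_ifs with h
  · exact grow_update h ha
  · exact Grow.refl _

theorem grow_tryStep {v a : ℕ} (ha : a ≤ 3) (col : ℕ → ℕ) : Grow col (tryStep n A v a col) := by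
  unfold tryStep
  split_ifs with h
  · exact Grow.refl _
  · exact (grow_place ha col).trans (grow_prop _)

theorem grow_solve (g : ℕ → ℕ) : Grow g (solve n A g) :=
  loopN_induct _ n g (fun _ y => Grow g y) (Grow.refl _) fun _ _ _ hy =>
    ((hy.trans (grow_tryStep (by omega) _)).trans (grow_tryStep (by omega) _)).trans
      (grow_tryStep (by omega) _)

/-- `prop` stops at a fixed point, so a vertex left uncoloured sees fewer than two colours. -/
theorem forced_prop {v : ℕ} (hv : v < n) (col : ℕ → ℕ) (h0 : prop n A col v = 0) :
    forced n A (prop n A col) v = 0 := by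
  have h := loopN_fixed (n := n) (f := propStep n A) (fun v col => (grow_propStep v col).1)
    (fun v hv col w hw => by
      unfold propStep
      split_ifs
      · rw [Function.update_of_ne (by omega)]
      · rfl) col hv
  change propStep n A v (prop n A col) = prop n A col at h
  rw [propStep, if_pos h0] at h
  simpa [h0] using congrFun h v

/-! ### Extendible partial colourings and the correctness of the trials -/

variable (n A) in
/-- `f` is a proper colouring that agrees with `col`. -/
def Ext (col f : ℕ → ℕ) : Prop :=
  ¬ Bad n A f ∧ ∀ v < n, (col v ≠ 0 → f v = col v) ∧ (col v = 0 → 1 ≤ f v ∧ f v ≤ 3)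

theorem Ext.not_bad {col f : ℕ → ℕ} (h : Ext n A col f) : ¬ Bad n A col := by
  rintro ⟨u, hu, v, hv, huv, heq, h1, h3⟩
  refine h.1 ⟨u, hu, v, hv, huv, ?_⟩
  rw [(h.2 u hu).1 (by omega), (h.2 v hv).1 (by omega)]
  exact ⟨heq, h1, h3⟩

theorem Ext.sees {col f : ℕ → ℕ} (h : Ext n A col f) {v a : ℕ} (hv : v < n) (ha : 1 ≤ a)
    (ha' : a ≤ 3) (hs : Sees n A col v a) : f v ≠ a := by
  rintro rfl
  obtain ⟨w, hw, hvw, hwa⟩ := hs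
  have h1 := (h.2 w hw).1 (by omega)
  exact h.1 ⟨v, hv, w, hw, hvw, by omega, by omega, by omega⟩

theorem Ext.update {col f : ℕ → ℕ} (h : Ext n A col f) {v : ℕ} (hv : v < n) :
    Ext n A (Function.update col v (f v)) f := by
  refine ⟨h.1, fun w hw => ?_⟩
  by_cases hwv : w = v
  · subst hwv
    have := h.2 w hw
    rw [Function.update_self]
    refine ⟨fun _ => rfl, fun h0 => ?_⟩
    by_cases hc : col w = 0
    · exact this.2 hc
    · exact absurd (this.1 hc) (by omega)
  · simpa only [Function.update_of_ne hwv] using h.2 w hw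

theorem Ext.propStep {col f : ℕ → ℕ} (h : Ext n A col f) {v : ℕ} (hv : v < n) :
    Ext n A (propStep n A v col) f := by
  unfold ThreeCol.propStep
  split_ifs with h0
  · have hf := (h.2 v hv).2 h0
    have s := fun a h1 h2 => h.sees hv (a := a) h1 h2
    unfold forced
    split_ifs with h1 h2 h3
    · have := s 2 (by omega) (by omega) h1.1
      have := s 3 (by omega) (by omega) h1.2
      rw [show 1 = f v by omega]; exact h.update hv
    · have := s 1 (by omega) (by omega) h2.1
      have := s 3 (by omega) (by omega) h2.2
      rw [show 2 = f v by omega]; exact h.update hv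
    · have := s 1 (by omega) (by omega) h3.1
      have := s 2 (by omega) (by omega) h3.2
      rw [show 3 = f v by omega]; exact h.update hv
    · rwa [← h0, Function.update_eq_self]
  · exact h

theorem Ext.prop {col f : ℕ → ℕ} (h : Ext n A col f) : Ext n A (prop n A col) f :=
  loopN_induct _ n col (fun _ y => Ext n A y f) h fun _ _ y hy =>
    loopN_induct _ n y (fun _ y => Ext n A y f) hy fun _ hi _ hy => hy.propStep hi

/-- This carries the refutation of a colour at an early trial over to every extension of a later
array. -/
theorem Ext.of_grow {col col' f : ℕ → ℕ} (h : Ext n A col' f) (hg : Grow col col') :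
    Ext n A col f := by
  refine ⟨h.1, fun v hv => ⟨fun h0 => ?_, fun h0 => ?_⟩⟩
  · have := hg.1 v h0
    rw [← this]
    exact (h.2 v hv).1 (by omega)
  · have h1 := hg.2 v h0
    have h2 := h.2 v hv
    by_cases hc : col' v = 0
    · exact h2.2 hc
    · have := h2.1 hc
      omega

variable (n A) in
/-- Every vertex that is not coloured has a coloured neighbour. -/
def Dom (g : ℕ → ℕ) : Prop := ∀ y < n, g y = 0 → ∃ w < n, A y w ∧ 1 ≤ g w ∧ g w ≤ 3

theorem forced_ne_zero {col : ℕ → ℕ} {v a b : ℕ} (ha : 1 ≤ a) (ha' : a ≤ 3) (hb : 1 ≤ b)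
    (hb' : b ≤ 3) (hab : a ≠ b) (hsa : Sees n A col v a) (hsb : Sees n A col v b) :
    forced n A col v ≠ 0 := by
  unfold forced
  interval_cases a <;> interval_cases b <;> simp_all <;> split_ifs <;> simp

/-- A consistent closed extension of an extendible partial colouring is extendible. -/
theorem Ext.merge (hA : ∀ u v, A u v → A v u) {g col c' f : ℕ → ℕ} (hd : Dom n A g)
    (hg : Grow g col) (h : Ext n A col f) (hg' : Grow col c') (hb : ¬ Bad n A c')
    (hcl : ∀ v < n, c' v = 0 → forced n A c' v = 0) :
    Ext n A c' (fun v => if c' v = 0 then f v else c' v) := by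
  have hzero : ∀ v, c' v = 0 → col v = 0 ∧ g v = 0 := by
    intro v hv
    have h1 : col v = 0 := by
      by_contra h; have := hg'.1 v h; omega
    exact ⟨h1, by by_contra h; have := hg.1 v h; omega⟩
  -- A vertex `u` uncoloured in `c'` has a neighbour `w` coloured by `g`, on which `f` and `c'`
  -- agree. If another neighbour has the colour `f u` in `c'`, then either `f` clashes at `u w`, or
  -- `u` sees two colours and would have been forced.
  have mixed : ∀ u < n, ∀ v < n, A u v → c' u = 0 → c' v = f u → 1 ≤ f u → f u ≤ 3 → False := by
    intro u hu v hv huv h0 heq h1 h3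
    obtain ⟨w, hw, huw, hw1, hw3⟩ := hd u hu (hzero u h0).2
    have hcw : col w = g w := hg.1 w (by omega)
    have hcw' : c' w = g w := (hg'.1 w (by omega)).trans hcw
    have hfw : f w = g w := ((h.2 w hw).1 (by omega)).trans hcw
    by_cases hab : f u = g w
    · exact h.1 ⟨u, hu, w, hw, huw, by omega, h1, h3⟩
    · exact forced_ne_zero h1 h3 hw1 hw3 hab ⟨v, hv, huv, heq⟩ ⟨w, hw, huw, hcw'⟩ (hcl u hu h0)
  refine ⟨?_, fun v hv => ⟨fun h0 => by simp [h0], fun h0 => ?_⟩⟩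
  · rintro ⟨u, hu, v, hv, huv, heq, h1, h3⟩
    by_cases hu0 : c' u = 0 <;> by_cases hv0 : c' v = 0 <;>
      simp only [hu0, hv0, if_true, if_false] at heq h1 h3
    · exact h.1 ⟨u, hu, v, hv, huv, heq, h1, h3⟩
    · exact mixed u hu v hv huv hu0 heq.symm h1 h3
    · exact mixed v hv u hu (hA _ _ huv) hv0 heq (by omega) (by omega)
    · exact hb ⟨u, hu, v, hv, huv, heq, h1, h3⟩
  · simp only [h0, if_true]
    exact (h.2 v hv).2 (hzero v h0).1

/-- An accepted trial stays extendible by `Ext.merge`. In a rejected one, an extension with colour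
`a` at `v` would survive propagation and rule out the conflict. -/
theorem tryStep_spec (hA : ∀ u v, A u v → A v u) {g col : ℕ → ℕ} (hd : Dom n A g)
    (hg : Grow g col) (hf : ∃ f, Ext n A col f) {v a : ℕ} (hv : v < n) (ha : 1 ≤ a)
    (ha' : a ≤ 3) :
    (∃ f, Ext n A (tryStep n A v a col) f) ∧
      (tryStep n A v a col v = 0 → ∀ f, Ext n A (tryStep n A v a col) f → f v ≠ a) := by
  obtain ⟨f, hf⟩ := hf
  have hg1 : Grow col (place v a col) := grow_place ha' col
  have hg2 : Grow (place v a col) (prop n A (place v a col)) := grow_prop _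
  unfold tryStep
  split_ifs with hb
  · refine ⟨⟨f, hf⟩, fun h0 f hf hfa => ?_⟩
    have h1 : Ext n A (place v a col) f := by
      rw [place, if_pos h0, ← hfa]; exact hf.update hv
    exact h1.prop.not_bad hb
  · refine ⟨⟨_, hf.merge hA hd hg (hg1.trans hg2) hb fun w hw h0 => forced_prop hw _ h0⟩,
      fun h0 => ?_⟩
    have h1 : place v a col v ≠ 0 := by
      unfold place
      split_ifs with h
      · simp; omega
      · exact h
    exact absurd ((hg2.1 v h1).symm.trans h0) h1

/-- The backtracking succeeds when it starts from an extendible dominating partial colouring. -/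
theorem good_of_ext (hA : ∀ u v, A u v → A v u) {g : ℕ → ℕ} (hd : Dom n A g)
    (hf : ∃ f, Ext n A g f) : Good n A g := by
  have key := loopN_induct
    (fun v col => tryStep n A v 3 (tryStep n A v 2 (tryStep n A v 1 col))) n g
    (fun i col => Grow g col ∧ (∃ f, Ext n A col f) ∧ ∀ v < i, col v ≠ 0)
    ⟨Grow.refl _, hf, by simp⟩ (by
      rintro i hi col ⟨hg, hf, hnz⟩
      have h1 := tryStep_spec hA hd hg hf hi (a := 1) (by omega) (by omega)
      have g1 := grow_tryStep (n := n) (A := A) (v := i) (a := 1) (by omega) col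
      set c1 := tryStep n A i 1 col
      have h2 := tryStep_spec hA hd (hg.trans g1) h1.1 hi (a := 2) (by omega) (by omega)
      have g2 := grow_tryStep (n := n) (A := A) (v := i) (a := 2) (by omega) c1
      set c2 := tryStep n A i 2 c1
      have h3 := tryStep_spec hA hd ((hg.trans g1).trans g2) h2.1 hi (a := 3) (by omega) (by omega)
      have g3 := grow_tryStep (n := n) (A := A) (v := i) (a := 3) (by omega) c2
      set c3 := tryStep n A i 3 c2
      refine ⟨((hg.trans g1).trans g2).trans g3, h3.1, fun v hv => ?_⟩
      have hlt : v < i ∨ v = i := by omega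
      rcases hlt with hvi | rfl
      · rw [((g1.trans g2).trans g3).1 v (hnz v hvi)]
        exact hnz v hvi
      · intro h0
        -- If `v` is still uncoloured after the three trials, all three colours are refuted, yet
        -- some extension gives `v` one of them.
        have z2 : c2 v = 0 := by by_contra h; have := g3.1 v h; omega
        have z1 : c1 v = 0 := by by_contra h; have := g2.1 v h; omega
        obtain ⟨f, hf⟩ := h3.1
        have a3 := h3.2 h0 f hf
        have a2 := h2.2 z2 f (hf.of_grow g3)
        have a1 := h1.2 z1 f ((hf.of_grow g3).of_grow g2)
        have := (hf.2 v hi).2 h0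
        omega)
  obtain ⟨_, ⟨f, hf⟩, hnz⟩ := key
  exact ⟨hf.not_bad, hnz⟩

/-! ### Guessing colours, and soundness of the answer -/

theorem GoodAfter.of_finset {k : ℕ} {D : Finset ℕ} (hDn : ∀ v ∈ D, v < n) (hD : D.card ≤ k)
    {g h : ℕ → ℕ} (hh : ∀ v ∈ D, 1 ≤ h v ∧ h v ≤ 3)
    (hgood : Good n A (fun v => if v ∈ D then h v else g v)) : GoodAfter n A k g := by
  induction k generalizing D g with
  | zero =>
    rw [Nat.le_zero, Finset.card_eq_zero] at hD
    subst hD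
    simpa [GoodAfter] using hgood
  | succ k ih =>
    rcases D.eq_empty_or_nonempty with rfl | ⟨v, hv⟩
    · exact Or.inl (ih (D := ∅) (by simp) (by simp) (by simp) hgood)
    · right
      refine ⟨v, hDn v hv, ?_⟩
      have hrec : GoodAfter n A k (Function.update g v (h v)) := by
        refine ih (D := D.erase v) (fun w hw => hDn w (Finset.mem_of_mem_erase hw)) ?_
          (fun w hw => hh w (Finset.mem_of_mem_erase hw)) ?_
        · rw [Finset.card_erase_of_mem hv]; omega
        · convert hgood using 2 with w
          by_cases hw : w = v
          · subst hw; simp [hv]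
          · simp [hw]
      have hv3 := hh v hv
      generalize h v = a at hrec hv3
      obtain ⟨h1, h3⟩ := hv3
      interval_cases a <;> tauto

/-- Guesses may hit any vertex, even a deleted one, but they write only genuine colours. -/
theorem GoodAfter.exists_good {k : ℕ} {g : ℕ → ℕ} (h : GoodAfter n A k g) :
    ∃ g', Good n A g' ∧ ∀ v, g' v = g v ∨ (1 ≤ g' v ∧ g' v ≤ 3) := by
  induction k generalizing g with
  | zero => exact ⟨g, h, fun v => Or.inl rfl⟩
  | succ k ih =>
    have aux : ∀ v a, 1 ≤ a → a ≤ 3 → GoodAfter n A k (Function.update g v a) →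
        ∃ g', Good n A g' ∧ ∀ v, g' v = g v ∨ (1 ≤ g' v ∧ g' v ≤ 3) := by
      intro v a h1 h3 ha
      obtain ⟨g', hg, hg'⟩ := ih ha
      refine ⟨g', hg, fun w => ?_⟩
      have := hg' w
      by_cases hw : w = v
      · subst hw
        simp only [Function.update_self] at this
        right; omega
      · rwa [Function.update_of_ne hw] at this
    rcases h with h | ⟨v, _, h | h | h⟩
    · exact ih h
    all_goals exact aux v _ (by omega) (by omega) h

variable (n A) in
/-- The vertices that are not deleted have a proper colouring. -/
def Live (g : ℕ → ℕ) : Prop :=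
  ∃ f : ℕ → ℕ, (∀ v < n, g v = 0 → 1 ≤ f v ∧ f v ≤ 3) ∧
    ∀ u < n, ∀ v < n, g u = 0 → g v = 0 → A u v → f u ≠ f v

theorem GoodAfter.live {k : ℕ} {g : ℕ → ℕ} (h : GoodAfter n A k g) : Live n A g := by
  obtain ⟨g', ⟨hb, hnz⟩, hg⟩ := h.exists_good
  have hgr := grow_solve (n := n) (A := A) g'
  have hval : ∀ v < n, g v = 0 → 1 ≤ solve n A g' v ∧ solve n A g' v ≤ 3 := by
    intro v hv h0
    have := hnz v hv
    have h1 := hg v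
    by_cases hz : g' v = 0
    · have := hgr.2 v hz; omega
    · have := hgr.1 v hz; omega
  refine ⟨solve n A g', hval, fun u hu v hv hu0 hv0 huv heq => ?_⟩
  exact hb ⟨u, hu, v, hv, huv, heq, hval u hu hu0⟩

/-- A deleted vertex has fewer than three live neighbours, so one of the three colours is free for
it. -/
theorem Live.of_coreStep (hA : ∀ u v, A u v → A v u) (hirr : ∀ v, ¬ A v v) {g : ℕ → ℕ} {v : ℕ}
    (h : Live n A (coreStep n A v g)) : Live n A g := by
  classical
  unfold coreStep at h
  split_ifs at h with hc
  · obtain ⟨f, hf, hp⟩ := h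
    obtain ⟨a, ha, hna⟩ : ∃ a ∈ Finset.Icc 1 3,
        a ∉ ((Finset.range n).filter (fun w => A v w ∧ g w = 0)).image f := by
      by_contra! hcon
      have := Finset.card_le_card (show Finset.Icc 1 3 ⊆ _ from hcon)
      have h2 := Finset.card_image_le (s := (Finset.range n).filter (fun w => A v w ∧ g w = 0))
        (f := f)
      simp only [Nat.card_Icc] at this
      convert lt_irrefl _ (lt_of_le_of_lt (this.trans h2) hc.2) using 1
    rw [Finset.mem_Icc] at ha
    have hna' : ∀ w < n, A v w → g w = 0 → f w ≠ a := by
      intro w hw hvw hw0 hfa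
      exact hna (Finset.mem_image.2 ⟨w, by simp [hw, hvw, hw0], hfa⟩)
    have hother : ∀ w, w ≠ v → g w = 0 → Function.update g v 4 w = 0 := by
      intro w hw h0; rwa [Function.update_of_ne hw]
    refine ⟨Function.update f v a, fun w hw h0 => ?_, fun u hu w hw hu0 hw0 huw => ?_⟩
    · by_cases hwv : w = v
      · subst hwv; simpa using ha
      · rw [Function.update_of_ne hwv]; exact hf w hw (hother w hwv h0)
    · by_cases huv : u = v
      · subst huv
        have hwu : w ≠ u := by rintro rfl; exact hirr _ huw
        rw [Function.update_self, Function.update_of_ne hwu]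
        exact (hna' w hw huw hw0).symm
      · by_cases hwv : w = v
        · subst hwv
          rw [Function.update_self, Function.update_of_ne huv]
          exact hna' u hu (hA _ _ huw) hu0
        · rw [Function.update_of_ne huv, Function.update_of_ne hwv]
          exact hp u hu w hw (hother u huv hu0) (hother w hwv hw0) huw
  · exact h

theorem Live.of_core (hA : ∀ u v, A u v → A v u) (hirr : ∀ v, ¬ A v v)
    (h : Live n A (core n A)) : Live n A (fun _ => 0) := by
  revert h
  refine loopN_induct _ n _ (fun _ y => Live n A y → Live n A (fun _ => 0)) id fun _ _ y hy => ?_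
  exact loopN_induct _ n _ (fun _ z => Live n A z → Live n A (fun _ => 0)) hy
    fun i _ z hz h => hz (h.of_coreStep hA hirr)

theorem core_eq (v : ℕ) : core n A v = 0 ∨ core n A v = 4 := by
  refine loopN_induct _ n _ (fun _ (y : ℕ → ℕ) => y v = 0 ∨ y v = 4) (Or.inl rfl) fun _ _ y hy => ?_
  refine loopN_induct _ n _ (fun _ (z : ℕ → ℕ) => z v = 0 ∨ z v = 4) hy fun i _ z hz => ?_
  unfold coreStep
  split_ifs
  · by_cases h : v = i
    · subst h; simp
    · rwa [Function.update_of_ne h]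
  · exact hz

-- At the fixed point of the deletion passes no live vertex qualifies for deletion.
open Classical in
theorem core_degree {v : ℕ} (hv : v < n) (h0 : core n A v = 0) :
    3 ≤ ((Finset.range n).filter (fun w => A v w ∧ core n A w = 0)).card := by
  have h := loopN_fixed (n := n) (f := coreStep n A)
    (fun v col w hw => by
      unfold coreStep
      split_ifs with hc
      · rw [Function.update_of_ne]; rintro rfl; exact hw hc.1
      · rfl)
    (fun v hv col w hw => by
      unfold coreStep
      split_ifs
      · rw [Function.update_of_ne (by omega)]
      · rfl) (fun _ => 0) hv
  change coreStep n A v (core n A) = core n A at h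
  by_contra hlt
  rw [coreStep, if_pos ⟨h0, not_le.1 hlt⟩] at h
  have := congrFun h v
  simp [h0] at this

end ThreeCol

/-! ## A language of for-loops for the random access machine

All loops run over `0, …, n - 1`, where `n` is the content of register `0`. -/

namespace ThreeCol

open RAM

inductive Cmd where
  | skip
  | assign (r : ℕ) (e : Exp)
  | write (k : ℕ) (i e : Exp)
  | seq (p q : Cmd)
  | ite (e : Exp) (p q : Cmd)
  | forN (r : ℕ) (p : Cmd)

namespace Cmd

/-- The final `setReg r n` matches the counter value with which the compiled loop exits. -/
def run (n : ℕ) : Cmd → State → State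
  | skip, σ => σ
  | assign r e, σ => σ.setReg r (e.eval σ)
  | write k i e, σ => σ.setArr k (i.eval σ) (e.eval σ)
  | seq p q, σ => q.run n (p.run n σ)
  | ite e p q, σ => if e.eval σ ≠ 0 then p.run n σ else q.run n σ
  | forN r p, σ => (loopN (fun i τ => p.run n (τ.setReg r i)) n σ).setReg r n

/-- A syntactic sufficient condition, Boolean so that `rfl` settles it for concrete commands. -/
def keepsReg (r : ℕ) : Cmd → Bool
  | skip => true
  | assign r' _ => r != r'
  | write _ _ _ => true
  | seq p q => p.keepsReg r && q.keepsReg r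
  | ite _ p q => p.keepsReg r && q.keepsReg r
  | forN r' p => r != r' && p.keepsReg r

def keepsArr (k : ℕ) : Cmd → Bool
  | skip => true
  | assign _ _ => true
  | write k' _ _ => k != k'
  | seq p q => p.keepsArr k && q.keepsArr k
  | ite _ p q => p.keepsArr k && q.keepsArr k
  | forN _ p => p.keepsArr k

/-- Loop counters are modified by their loops only, and register `0` is not modified. -/
def wf : Cmd → Bool
  | skip => true
  | assign r _ => r != 0
  | write _ _ _ => true
  | seq p q => p.wf && q.wf
  | ite _ p q => p.wf && q.wf
  | forN r p => r != 0 && p.keepsReg r && p.wf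

def compile : Cmd → Prog
  | skip => .skip
  | assign r e => .assign r e
  | write k i e => .write k i e
  | seq p q => .seq p.compile q.compile
  | ite e p q => .ite e p.compile q.compile
  | forN r p => .seq (.assign r (.const 0)) (.loop (.sub (.reg 0) (.reg r))
      (.seq p.compile (.assign r (.add (.reg r) (.const 1)))))

/-- A bound for the number of steps. -/
noncomputable def time : Cmd → Polynomial ℕ
  | skip => 1
  | assign _ e => Polynomial.C (e.cost + 1)
  | write _ i e => Polynomial.C (i.cost + e.cost + 1)
  | seq p q => p.time + q.time
  | ite e p q => Polynomial.C (e.cost + 1) + p.time + q.time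
  -- Initialisation costs 2 and the last test 4; each round adds 4 for its test and 4 for the
  -- increment.
  | forN _ p => 6 + Polynomial.X * (p.time + 8)

variable {n : ℕ}

theorem run_reg {r : ℕ} : ∀ {p : Cmd} (_ : p.keepsReg r = true) (σ : State),
    (p.run n σ).reg r = σ.reg r
  | skip, _, σ => rfl
  | assign r' e, h, σ => by
    simp only [keepsReg, bne_iff_ne] at h
    simp [run, State.setReg, Function.update_of_ne h]
  | write _ _ _, _, σ => rfl
  | seq p q, h, σ => by
    simp only [keepsReg, Bool.and_eq_true] at h
    rw [run, run_reg h.2, run_reg h.1]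
  | ite e p q, h, σ => by
    simp only [keepsReg, Bool.and_eq_true] at h
    rw [run]
    split_ifs
    · rw [run_reg h.1]
    · rw [run_reg h.2]
  | forN r' p, h, σ => by
    simp only [keepsReg, Bool.and_eq_true, bne_iff_ne] at h
    have : (loopN (fun i τ => p.run n (τ.setReg r' i)) n σ).reg r = σ.reg r := by
      refine loopN_induct _ n σ (fun _ τ => τ.reg r = σ.reg r) rfl fun i _ τ hτ => ?_
      rw [run_reg h.2]
      simpa [State.setReg, Function.update_of_ne h.1] using hτ
    simpa [run, State.setReg, Function.update_of_ne h.1] using this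

theorem run_arr {k : ℕ} : ∀ {p : Cmd} (_ : p.keepsArr k = true) (σ : State),
    (p.run n σ).arr k = σ.arr k
  | skip, _, σ => rfl
  | assign _ _, _, σ => rfl
  | write k' _ _, h, σ => by
    simp only [keepsArr, bne_iff_ne] at h
    simp [run, State.setArr, Function.update_of_ne h]
  | seq p q, h, σ => by
    simp only [keepsArr, Bool.and_eq_true] at h
    rw [run, run_arr h.2, run_arr h.1]
  | ite e p q, h, σ => by
    simp only [keepsArr, Bool.and_eq_true] at h
    rw [run]
    split_ifs
    · rw [run_arr h.1]
    · rw [run_arr h.2]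
  | forN r' p, h, σ => by
    have : (loopN (fun i τ => p.run n (τ.setReg r' i)) n σ).arr k = σ.arr k := by
      refine loopN_induct _ n σ (fun _ τ => τ.arr k = σ.arr k) rfl fun i _ τ hτ => ?_
      rw [run_arr (p := p) h]
      exact hτ
    exact this

theorem keepsReg_zero : ∀ {p : Cmd}, p.wf = true → p.keepsReg 0 = true
  | skip, _ => rfl
  | assign r e, h => by
    simp only [wf, keepsReg, bne_iff_ne] at h ⊢
    exact h.symm
  | write _ _ _, _ => rfl
  | seq p q, h => by
    simp only [wf, Bool.and_eq_true] at h
    simp [keepsReg, keepsReg_zero h.1, keepsReg_zero h.2]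
  | ite e p q, h => by
    simp only [wf, Bool.and_eq_true] at h
    simp [keepsReg, keepsReg_zero h.1, keepsReg_zero h.2]
  | forN r p, h => by
    simp only [wf, Bool.and_eq_true, bne_iff_ne] at h
    simp [keepsReg, keepsReg_zero h.2, h.1.1.symm]

/-- A compiled program computes its meaning within its time bound. -/
theorem runs_compile : ∀ {p : Cmd} (_ : p.wf = true) (σ : State), σ.reg 0 = n →
    ∃ t, Runs p.compile σ t (p.run n σ) ∧ t ≤ p.time.eval n
  | skip, _, σ, _ => ⟨1, .skip σ, by simp [time]⟩
  | assign r e, _, σ, _ => ⟨_, .assign r e σ, by simp [time]⟩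
  | write k i e, _, σ, _ => ⟨_, .write k i e σ, by simp [time]⟩
  | seq p q, h, σ, h0 => by
    simp only [wf, Bool.and_eq_true] at h
    obtain ⟨t, ht, htle⟩ := runs_compile h.1 σ h0
    obtain ⟨u, hu, hule⟩ := runs_compile h.2 (p.run n σ)
      ((run_reg (keepsReg_zero h.1) σ).trans h0)
    exact ⟨t + u, .seq ht hu, by simp only [time, Polynomial.eval_add]; omega⟩
  | ite e p q, h, σ, h0 => by
    simp only [wf, Bool.and_eq_true] at h
    by_cases he : e.eval σ = 0
    · obtain ⟨t, ht, htle⟩ := runs_compile h.2 σ h0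
      refine ⟨e.cost + 1 + t, ?_, by simp only [time, Polynomial.eval_add, Polynomial.eval_C]; omega⟩
      simp only [run, he]
      exact .ite_false he ht
    · obtain ⟨t, ht, htle⟩ := runs_compile h.1 σ h0
      refine ⟨e.cost + 1 + t, ?_, by simp only [time, Polynomial.eval_add, Polynomial.eval_C]; omega⟩
      simp only [run, ne_eq, he, not_false_eq_true, if_true]
      exact .ite_true he ht
  | forN r p, h, σ, h0 => by
    simp only [wf, Bool.and_eq_true, bne_iff_ne] at h
    obtain ⟨⟨hr, hkr⟩, hp⟩ := h
    let L : ℕ → State := fun i => loopN (fun i τ => p.run n (τ.setReg r i)) i σ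
    have hL0 : ∀ i, (L i).reg 0 = n := fun i => by
      refine loopN_induct _ i σ (fun _ τ => τ.reg 0 = n) h0 fun i _ τ hτ => ?_
      rw [run_reg (keepsReg_zero hp)]
      simpa [State.setReg, Function.update_of_ne hr.symm] using hτ
    have hcond : ∀ i, (Exp.sub (.reg 0) (.reg r)).eval ((L i).setReg r i) = n - i := fun i => by
      simp [Exp.eval, State.setReg, Function.update_of_ne hr.symm, hL0]
    have hloop : ∀ m i, i + m = n → ∃ t, Runs (.loop (.sub (.reg 0) (.reg r))
        (.seq p.compile (.assign r (.add (.reg r) (.const 1))))) ((L i).setReg r i) t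
        ((L n).setReg r n) ∧ t ≤ 4 + m * (p.time.eval n + 8) := by
      intro m
      induction m with
      | zero =>
        rintro i rfl
        exact ⟨_, .loop_done (by rw [hcond]; omega), by simp [Exp.cost]⟩
      | succ m ih =>
        intro i hi
        obtain ⟨u, hu, hule⟩ := ih (i + 1) (by omega)
        obtain ⟨t, ht, htle⟩ := runs_compile hp ((L i).setReg r i)
          (by simp [State.setReg, Function.update_of_ne hr.symm, hL0])
        have hstep : (p.run n ((L i).setReg r i)).setReg r
            ((Exp.add (.reg r) (.const 1)).eval (p.run n ((L i).setReg r i))) =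
            (L (i + 1)).setReg r (i + 1) := by
          simp only [Exp.eval, run_reg hkr]
          simp [State.setReg, L, loopN]
        have ha := Runs.assign r (.add (.reg r) (.const 1)) (p.run n ((L i).setReg r i))
        rw [hstep] at ha
        refine ⟨_, .loop_step (by rw [hcond]; omega) (.seq ht ha) hu, ?_⟩
        simp only [Exp.cost]
        rw [Nat.succ_mul]
        omega
    obtain ⟨t, ht, htle⟩ := hloop n 0 (by omega)
    refine ⟨_, .seq (.assign r (.const 0) σ) ht, ?_⟩
    simp only [time, Polynomial.eval_add, Polynomial.eval_mul, Polynomial.eval_X,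
      Polynomial.eval_ofNat, Exp.cost]
    omega

/-- A for-loop acts as a loop on every quantity that it leaves alone between its rounds. -/
theorem run_forN {α : Type} {r : ℕ} {p : Cmd} (φ : State → α) (I : State → Prop)
    (f : ℕ → α → α) (hI : ∀ σ i, I σ → I (σ.setReg r i)) (hφ : ∀ σ i, φ (σ.setReg r i) = φ σ)
    (h : ∀ i < n, ∀ σ, I σ → σ.reg r = i → I (p.run n σ) ∧ φ (p.run n σ) = f i (φ σ))
    {σ : State} (hσ : I σ) :
    I ((forN r p).run n σ) ∧ φ ((forN r p).run n σ) = loopN f n (φ σ) := by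
  have key : ∀ m ≤ n, I (loopN (fun i τ => p.run n (τ.setReg r i)) m σ) ∧
      φ (loopN (fun i τ => p.run n (τ.setReg r i)) m σ) = loopN f m (φ σ) := by
    intro m
    induction m with
    | zero => exact fun _ => ⟨hσ, rfl⟩
    | succ m ih =>
      intro hm
      obtain ⟨h1, h2⟩ := ih (by omega)
      have := h m hm _ (hI _ m h1) (by simp [State.setReg])
      rw [hφ, h2] at this
      exact this
  obtain ⟨h1, h2⟩ := key n le_rfl
  exact ⟨hI _ _ h1, (hφ _ _).trans h2⟩

end Cmd

end ThreeCol

namespace ThreeCol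

open RAM Cmd

/-! ## Expressions and the view of an array -/

/-- With truncated subtraction, the sum of the two differences vanishes exactly when the values
agree. -/
def eqE (e f : Exp) : Exp := .sub (.const 1) (.add (.sub e f) (.sub f e))

def andE (e f : Exp) : Exp := .sub (.add e f) (.const 1)

/-- The entry of the adjacency matrix at the vertices in registers `u` and `v`; array `3` holds the
beginnings of the rows. -/
def adjE (u v : ℕ) : Exp := .read 0 (.add (.read 3 (.reg u)) (.reg v))

/-- The first `n` entries of array `k`. -/
def view (n k : ℕ) (σ : State) : ℕ → ℕ := fun i => if i < n then σ.arr k i else 0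

open Classical in
noncomputable def ind (p : Prop) : ℕ := if p then 1 else 0

/-- The memory holds the graph and the beginnings of the rows of its matrix. -/
structure Inv (n : ℕ) (A : ℕ → ℕ → Prop) (σ : State) : Prop where
  size : σ.reg 0 = n
  adj : ∀ u < n, ∀ v < n, σ.arr 0 (u * n + v) = ind (A u v)
  rows : ∀ u < n, σ.arr 3 u = u * n

theorem eval_eqE (e f : Exp) (σ : State) :
    (eqE e f).eval σ = ind (e.eval σ = f.eval σ) := by
  simp only [eqE, Exp.eval, ind]; split_ifs <;> omega

theorem eval_andE {e f : Exp} {σ : State} {p q : Prop} (he : e.eval σ = ind p)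
    (hf : f.eval σ = ind q) : (andE e f).eval σ = ind (p ∧ q) := by
  by_cases hp : p <;> by_cases hq : q <;> simp [andE, Exp.eval, he, hf, hp, hq, ind]

theorem setReg_reg_self (σ : State) (r v : ℕ) : (σ.setReg r v).reg r = v := by
  simp [State.setReg]

theorem setReg_reg_of_ne (σ : State) {r r' : ℕ} (v : ℕ) (h : r' ≠ r) :
    (σ.setReg r v).reg r' = σ.reg r' := by
  simp [State.setReg, h]

variable {n : ℕ} {A : ℕ → ℕ → Prop}

theorem view_of_lt {k i : ℕ} (σ : State) (hi : i < n) : view n k σ i = σ.arr k i := if_pos hi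

theorem view_congr {k : ℕ} {σ τ : State} (h : τ.arr k = σ.arr k) : view n k τ = view n k σ := by
  funext i
  simp only [view, h]

theorem view_setArr {k i : ℕ} (σ : State) (v : ℕ) (hi : i < n) :
    view n k (σ.setArr k i v) = Function.update (view n k σ) i v := by
  funext j
  by_cases hj : j = i
  · subst hj; simp [view, State.setArr, hi]
  · simp [view, State.setArr, hj]

theorem Inv.of_eq {σ τ : State} (h : Inv n A σ) (h0 : τ.reg 0 = σ.reg 0)
    (ha : τ.arr 0 = σ.arr 0) (hr : τ.arr 3 = σ.arr 3) : Inv n A τ :=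
  ⟨h0.trans h.size, by rw [ha]; exact h.adj, by rw [hr]; exact h.rows⟩

theorem Inv.setReg {σ : State} (h : Inv n A σ) {r : ℕ} (hr : 0 ≠ r) (v : ℕ) :
    Inv n A (σ.setReg r v) :=
  h.of_eq (setReg_reg_of_ne σ v hr) rfl rfl

theorem Inv.run {σ : State} (h : Inv n A σ) {p : Cmd} (h0 : p.keepsReg 0 = true)
    (ha : p.keepsArr 0 = true) (hr : p.keepsArr 3 = true) : Inv n A (p.run n σ) :=
  h.of_eq (run_reg h0 σ) (run_arr ha σ) (run_arr hr σ)

theorem run_view {k : ℕ} {p : Cmd} (h : p.keepsArr k = true) (σ : State) :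
    view n k (p.run n σ) = view n k σ := view_congr (run_arr h σ)

theorem Inv.eval_adjE {σ : State} (h : Inv n A σ) {u v : ℕ} (hu : σ.reg u < n)
    (hv : σ.reg v < n) :
    (adjE u v).eval σ = ind (A (σ.reg u) (σ.reg v)) := by
  simp only [adjE, Exp.eval, h.rows _ hu, h.adj _ hu _ hv]

/-! ## Counting and copying -/

/-- Count in register `c` the values of register `w` below `n` for which the test `e` succeeds. -/
def countC (w c : ℕ) (e : Exp) : Cmd :=
  .seq (.assign c (.const 0)) (.forN w (.assign c (.add (.reg c) e)))

/-- The test is evaluated in states where the two working registers have changed, so its value must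
be known in every state that agrees with `σ` elsewhere. -/
theorem run_countC {w c : ℕ} {e : Exp} (hwc : w ≠ c) {σ : State} {p : ℕ → Prop}
    [DecidablePred p]
    (h : ∀ i < n, ∀ τ : State, τ.arr = σ.arr → (∀ r, r ≠ w → r ≠ c → τ.reg r = σ.reg r) →
      τ.reg w = i → e.eval τ = ind (p i)) :
    ((countC w c e).run n σ).reg c = ((Finset.range n).filter p).card := by
  have key := loopN_induct (fun i τ => (Cmd.assign c (.add (.reg c) e)).run n (τ.setReg w i)) n
    (σ.setReg c 0)
    (fun i τ => τ.arr = σ.arr ∧ (∀ r, r ≠ w → r ≠ c → τ.reg r = σ.reg r) ∧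
      τ.reg c = ((Finset.range i).filter p).card)
    ⟨rfl, fun r _ hr => setReg_reg_of_ne σ 0 hr, by simp [setReg_reg_self]⟩ (by
      rintro i hi τ ⟨ha, hr, hc⟩
      have he := h i hi (τ.setReg w i) ha
        (fun r h1 h2 => (setReg_reg_of_ne τ i h1).trans (hr r h1 h2)) (setReg_reg_self τ w i)
      refine ⟨ha, fun r h1 h2 => ?_, ?_⟩
      · rw [Cmd.run, setReg_reg_of_ne _ _ h2, setReg_reg_of_ne _ _ h1, hr r h1 h2]
      · rw [Cmd.run, setReg_reg_self, Exp.eval, he, Exp.eval, setReg_reg_of_ne _ _ hwc.symm, hc,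
          Finset.range_add_one, Finset.filter_insert, ind]
        split_ifs with hp
        · rw [Finset.card_insert_of_notMem (by simp)]
        · rfl)
  exact (setReg_reg_of_ne _ _ hwc.symm).trans key.2.2

def copyC (k l : ℕ) : Cmd := .forN 11 (.write l (.reg 11) (.read k (.reg 11)))

theorem view_copyC {k l : ℕ} (hkl : k ≠ l) (σ : State) :
    view n l ((copyC k l).run n σ) = view n k σ := by
  have key := loopN_induct
    (fun i τ => (Cmd.write l (.reg 11) (.read k (.reg 11))).run n (τ.setReg 11 i)) n σ
    (fun i τ => τ.arr k = σ.arr k ∧ ∀ j < i, τ.arr l j = σ.arr k j) ⟨rfl, by simp⟩ (by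
      rintro i hi τ ⟨hk, hl⟩
      refine ⟨?_, fun j hj => ?_⟩
      · simpa [Cmd.run, State.setArr, State.setReg, Function.update_of_ne hkl] using hk
      · by_cases hji : j = i
        · subst hji
          simp [Cmd.run, State.setArr, State.setReg, Exp.eval, hk]
        · simpa [Cmd.run, State.setArr, State.setReg, Exp.eval, Function.update_of_ne hji] using
            hl j (by omega))
  funext j
  unfold view
  split_ifs with hj
  · exact key.2 j hj
  · rfl

/-! ## Propagation -/

def seesC (a c : ℕ) : Cmd := countC 5 c (andE (adjE 4 5) (eqE (.read 6 (.reg 5)) (.const a)))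

theorem reg_seesC {a c : ℕ} (hc : c = 6 ∨ c = 7 ∨ c = 8) {σ : State} (hσ : Inv n A σ)
    (hv : σ.reg 4 < n) :
    ((seesC a c).run n σ).reg c ≠ 0 ↔ Sees n A (view n 6 σ) (σ.reg 4) a := by
  classical
  rw [seesC, run_countC (p := fun w => A (σ.reg 4) w ∧ σ.arr 6 w = a) (by omega)]
  · rw [Finset.card_ne_zero]
    constructor
    · rintro ⟨w, hw⟩
      simp only [Finset.mem_filter, Finset.mem_range] at hw
      exact ⟨w, hw.1, hw.2.1, (view_of_lt σ hw.1).trans hw.2.2⟩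
    · rintro ⟨w, hw, hvw, ha⟩
      rw [view_of_lt σ hw] at ha
      exact ⟨w, by simp [hw, hvw, ha]⟩
  · intro i hi τ ha hr hw
    have h4 : τ.reg 4 = σ.reg 4 := hr 4 (by omega) (by omega)
    have hτ : Inv n A τ := hσ.of_eq (hr 0 (by omega) (by omega)) (by rw [ha]) (by rw [ha])
    apply eval_andE
    · rw [hτ.eval_adjE (u := 4) (v := 5) (by omega) (by omega), h4, hw]
    · rw [eval_eqE]
      simp only [Exp.eval, hw, ha]

def propStepC : Cmd :=
  .ite (.read 6 (.reg 4)) .skip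
    (.seq (seesC 1 6) (.seq (seesC 2 7) (.seq (seesC 3 8)
      (.ite (.reg 7)
        (.ite (.reg 8) (.write 6 (.reg 4) (.const 1))
          (.ite (.reg 6) (.write 6 (.reg 4) (.const 3)) .skip))
        (.ite (.reg 6) (.ite (.reg 8) (.write 6 (.reg 4) (.const 2)) .skip) .skip)))))

theorem view_propStepC {σ : State} (hσ : Inv n A σ) {v : ℕ} (hv : v < n) (h4 : σ.reg 4 = v) :
    view n 6 (propStepC.run n σ) = propStep n A v (view n 6 σ) := by
  classical
  subst h4
  by_cases h0 : σ.arr 6 (σ.reg 4) = 0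
  · set σ1 := (seesC 1 6).run n σ with hσ1
    set σ2 := (seesC 2 7).run n σ1 with hσ2
    set σ3 := (seesC 3 8).run n σ2 with hσ3
    have a1 : σ1.arr 6 = σ.arr 6 := run_arr rfl σ
    have a2 : σ2.arr 6 = σ.arr 6 := (run_arr rfl σ1).trans a1
    have a3 : σ3.arr 6 = σ.arr 6 := (run_arr rfl σ2).trans a2
    have b1 : σ1.reg 4 = σ.reg 4 := run_reg rfl σ
    have b2 : σ2.reg 4 = σ.reg 4 := (run_reg rfl σ1).trans b1
    have b3 : σ3.reg 4 = σ.reg 4 := (run_reg rfl σ2).trans b2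
    have i1 : Inv n A σ1 := hσ.run rfl rfl rfl
    have i2 : Inv n A σ2 := i1.run rfl rfl rfl
    have s1 : σ3.reg 6 ≠ 0 ↔ Sees n A (view n 6 σ) (σ.reg 4) 1 := by
      rw [hσ3, run_reg rfl, hσ2, run_reg rfl]
      exact reg_seesC (by omega) hσ hv
    have s2 : σ3.reg 7 ≠ 0 ↔ Sees n A (view n 6 σ) (σ.reg 4) 2 := by
      rw [hσ3, run_reg rfl, ← view_congr a1, ← b1]
      exact reg_seesC (by omega) i1 (b1 ▸ hv)
    have s3 : σ3.reg 8 ≠ 0 ↔ Sees n A (view n 6 σ) (σ.reg 4) 3 := by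
      rw [← view_congr a2, ← b2]
      exact reg_seesC (by omega) i2 (b2 ▸ hv)
    have hw : ∀ a, view n 6 (σ3.setArr 6 (σ.reg 4) a) =
        Function.update (view n 6 σ) (σ.reg 4) a := fun a => by
      rw [view_setArr _ _ hv, view_congr a3]
    have hz : view n 6 σ (σ.reg 4) = 0 := (view_of_lt σ hv).trans h0
    have hskip : view n 6 σ3 = Function.update (view n 6 σ) (σ.reg 4) 0 := by
      rw [view_congr a3, ← hz, Function.update_eq_self]
    rw [propStep, if_pos hz, forced, ← s1, ← s2, ← s3]
    simp only [propStepC, Cmd.run, Exp.eval, h0, ne_eq, not_true_eq_false, if_false, ← hσ1, ← hσ2,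
      ← hσ3, b3]
    by_cases r6 : σ3.reg 6 = 0 <;> by_cases r7 : σ3.reg 7 = 0 <;> by_cases r8 : σ3.reg 8 = 0 <;>
      simp [r6, r7, r8, hw, hskip]
  · have : view n 6 σ (σ.reg 4) ≠ 0 := by rwa [view_of_lt σ hv]
    rw [propStep, if_neg this]
    simp [propStepC, Cmd.run, Exp.eval, h0]

def propC : Cmd := .forN 10 (.forN 4 propStepC)

theorem view_propC {σ : State} (hσ : Inv n A σ) :
    view n 6 (propC.run n σ) = prop n A (view n 6 σ) := by
  refine (run_forN (view n 6) (Inv n A) (fun _ => loopN (propStep n A) n)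
    (fun σ i h => h.setReg (by omega) i) (fun _ _ => rfl) (fun _ _ τ hτ _ => ?_) hσ).2
  exact run_forN (view n 6) (Inv n A) (propStep n A)
    (fun σ i h => h.setReg (by omega) i) (fun _ _ => rfl)
    (fun v hv ρ hρ h4 => ⟨hρ.run rfl rfl rfl, view_propStepC hρ hv h4⟩) hτ

/-! ## Conflicts -/

/-- For the colour `x` of the first vertex, `1 - (1 - x)` tests `1 ≤ x` and `1 - (x - 3)` tests `x ≤
3`. -/
def badE : Exp :=
  andE (andE (adjE 4 5) (eqE (.read 6 (.reg 4)) (.read 6 (.reg 5))))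
    (andE (.sub (.const 1) (.sub (.const 1) (.read 6 (.reg 4))))
      (.sub (.const 1) (.sub (.read 6 (.reg 4)) (.const 3))))

def badC : Cmd :=
  .seq (.assign 2 (.const 0))
    (.forN 4 (.seq (countC 5 6 badE) (.assign 2 (.add (.reg 2) (.reg 6)))))

theorem reg_badC {σ : State} (hσ : Inv n A σ) :
    (badC.run n σ).reg 2 ≠ 0 ↔ Bad n A (view n 6 σ) := by
  classical
  let p : ℕ → ℕ → Prop := fun u v =>
    (A u v ∧ σ.arr 6 u = σ.arr 6 v) ∧ (1 ≤ σ.arr 6 u ∧ σ.arr 6 u ≤ 3)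
  have hcount : ∀ τ : State, Inv n A τ → τ.arr 6 = σ.arr 6 → τ.reg 4 < n →
      ((countC 5 6 badE).run n τ).reg 6 = ((Finset.range n).filter (p (τ.reg 4))).card := by
    intro τ hτ h6 h4
    refine run_countC (w := 5) (c := 6) (by decide) fun i hi ρ ha hr hw => ?_
    have h4' : ρ.reg 4 = τ.reg 4 := hr 4 (by omega) (by omega)
    have hρ : Inv n A ρ := hτ.of_eq (hr 0 (by omega) (by omega)) (by rw [ha]) (by rw [ha])
    apply eval_andE <;> apply eval_andE
    · rw [hρ.eval_adjE (u := 4) (v := 5) (by omega) (by omega), h4', hw]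
    · rw [eval_eqE]
      simp only [Exp.eval, hw, ha, h6, h4']
    · simp only [Exp.eval, ha, h6, h4', ind]
      split_ifs <;> omega
    · simp only [Exp.eval, ha, h6, h4', ind]
      split_ifs <;> omega
  have key := loopN_induct
    (fun i τ => (Cmd.seq (countC 5 6 badE) (.assign 2 (.add (.reg 2) (.reg 6)))).run n
      (τ.setReg 4 i)) n (σ.setReg 2 0)
    (fun i τ => Inv n A τ ∧ τ.arr 6 = σ.arr 6 ∧ (τ.reg 2 ≠ 0 ↔ ∃ u < i, ∃ v < n, p u v))
    ⟨hσ.setReg (by omega) 0, rfl, by simp [setReg_reg_self]⟩ (by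
      rintro i hi τ ⟨h1, h2, h3⟩
      have hτ' : Inv n A (τ.setReg 4 i) := h1.setReg (by omega) i
      refine ⟨hτ'.run rfl rfl rfl, (run_arr rfl _).trans h2, ?_⟩
      have hc := hcount (τ.setReg 4 i) hτ' h2 (by rwa [setReg_reg_self])
      have hr2 : ((countC 5 6 badE).run n (τ.setReg 4 i)).reg 2 = τ.reg 2 :=
        (run_reg rfl _).trans (setReg_reg_of_ne _ _ (by omega))
      rw [Cmd.run, Cmd.run, setReg_reg_self, Exp.eval, Exp.eval, Exp.eval, hc, hr2,
        setReg_reg_self, show ∀ a b : ℕ, (a + b ≠ 0 ↔ a ≠ 0 ∨ b ≠ 0) by omega, h3, Finset.card_ne_zero]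
      constructor
      · rintro (⟨u, hu, h⟩ | ⟨v, hv⟩)
        · exact ⟨u, by omega, h⟩
        · simp only [Finset.mem_filter, Finset.mem_range] at hv
          exact ⟨i, by omega, v, hv⟩
      · rintro ⟨u, hu, v, hv, h⟩
        have : u < i ∨ u = i := by omega
        rcases this with hu | rfl
        · exact Or.inl ⟨u, hu, v, hv, h⟩
        · exact Or.inr ⟨v, by simp [hv, h]⟩)
  rw [show (badC.run n σ).reg 2 = _ from setReg_reg_of_ne _ _ (by decide : 2 ≠ 4)]
  refine key.2.2.trans ?_
  constructor
  · rintro ⟨u, hu, v, hv, h⟩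
    refine ⟨u, hu, v, hv, ?_⟩
    rw [view_of_lt σ hu, view_of_lt σ hv]
    exact ⟨h.1.1, h.1.2, h.2⟩
  · rintro ⟨u, hu, v, hv, h⟩
    refine ⟨u, hu, v, hv, ?_⟩
    rw [view_of_lt σ hu, view_of_lt σ hv] at h
    exact ⟨⟨h.1, h.2.1⟩, h.2.2⟩

/-! ## Backtracking -/

def placeC (a : ℕ) : Cmd := .ite (.read 6 (.reg 9)) .skip (.write 6 (.reg 9) (.const a))

theorem view_placeC (a : ℕ) {σ : State} (hv : σ.reg 9 < n) :
    view n 6 ((placeC a).run n σ) = place (σ.reg 9) a (view n 6 σ) := by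
  rw [place, view_of_lt σ hv]
  by_cases h : σ.arr 6 (σ.reg 9) = 0
  · simpa [placeC, Cmd.run, Exp.eval, h] using view_setArr σ a hv
  · simp [placeC, Cmd.run, Exp.eval, h]

/-- Array `7` is the backup from which a conflicting trial is undone. -/
def tryC (a : ℕ) : Cmd :=
  .seq (copyC 6 7) (.seq (placeC a) (.seq propC (.seq badC (.ite (.reg 2) (copyC 7 6) .skip))))

theorem view_tryC (a : ℕ) {σ : State} (hσ : Inv n A σ) {v : ℕ} (hv : v < n) (h9 : σ.reg 9 = v) :
    view n 6 ((tryC a).run n σ) = tryStep n A v a (view n 6 σ) := by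
  subst h9
  set σ1 := (copyC 6 7).run n σ with hσ1
  set σ2 := (placeC a).run n σ1 with hσ2
  set σ3 := propC.run n σ2 with hσ3
  set σ4 := badC.run n σ3 with hσ4
  have i1 : Inv n A σ1 := hσ.run rfl rfl rfl
  have i2 : Inv n A σ2 := i1.run rfl rfl rfl
  have i3 : Inv n A σ3 := i2.run rfl rfl rfl
  have r1 : σ1.reg 9 = σ.reg 9 := run_reg rfl σ
  have c1 : view n 6 σ1 = view n 6 σ := run_view rfl σ
  have c2 : view n 6 σ2 = place (σ.reg 9) a (view n 6 σ) := by
    rw [hσ2, view_placeC a (r1 ▸ hv), r1, c1]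
  have c3 : view n 6 σ3 = prop n A (place (σ.reg 9) a (view n 6 σ)) := by
    rw [hσ3, view_propC i2, c2]
  have c4 : view n 6 σ4 = view n 6 σ3 := run_view rfl σ3
  have s4 : view n 7 σ4 = view n 6 σ := by
    rw [hσ4, run_view rfl, hσ3, run_view rfl, hσ2, run_view rfl, hσ1, view_copyC (by omega)]
  have hb : σ4.reg 2 ≠ 0 ↔ Bad n A (prop n A (place (σ.reg 9) a (view n 6 σ))) := by
    rw [hσ4, reg_badC i3, c3]
  simp only [tryC, Cmd.run, Exp.eval, ← hσ1, ← hσ2, ← hσ3, ← hσ4]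
  unfold tryStep
  rw [← hb]
  by_cases h : σ4.reg 2 = 0
  · simp only [h, ne_eq, not_true_eq_false, if_false]
    rw [c4, c3]
  · simp only [h, ne_eq, not_false_eq_true, if_true]
    rw [view_copyC (by omega), s4]

/-- The search works on a copy in array `6`, so the guesses in array `5` survive. -/
def solveC : Cmd :=
  .seq (copyC 5 6) (.forN 9 (.seq (tryC 1) (.seq (tryC 2) (tryC 3))))

theorem view_solveC {σ : State} (hσ : Inv n A σ) :
    view n 6 (solveC.run n σ) = solve n A (view n 5 σ) := by
  have hi : Inv n A ((copyC 5 6).run n σ) := hσ.run rfl rfl rfl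
  rw [solveC, Cmd.run, ← view_copyC (k := 5) (l := 6) (by omega) σ]
  refine (run_forN (view n 6) (Inv n A) _ (fun σ i h => h.setReg (by omega) i) (fun _ _ => rfl)
    (fun v hv τ hτ h9 => ⟨hτ.run rfl rfl rfl, ?_⟩) hi).2
  have i1 : Inv n A ((tryC 1).run n τ) := hτ.run rfl rfl rfl
  have i2 : Inv n A ((tryC 2).run n ((tryC 1).run n τ)) := i1.run rfl rfl rfl
  have r1 : ((tryC 1).run n τ).reg 9 = v := (run_reg rfl τ).trans h9
  have r2 : ((tryC 2).run n ((tryC 1).run n τ)).reg 9 = v := (run_reg rfl _).trans r1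
  rw [Cmd.run, Cmd.run, view_tryC 3 i2 hv r2, view_tryC 2 i1 hv r1, view_tryC 1 hτ hv h9]

/-! ## Guessing -/

open Classical in
/-- The command sets register `1` to one if the array `5` satisfies `Q`, and it restores this
array. -/
def Decides (n : ℕ) (A : ℕ → ℕ → Prop) (p : Cmd) (Q : (ℕ → ℕ) → Prop) : Prop :=
  ∀ σ, Inv n A σ → Inv n A (p.run n σ) ∧ view n 5 (p.run n σ) = view n 5 σ ∧
    (p.run n σ).reg 1 = if Q (view n 5 σ) then 1 else σ.reg 1

def goodC : Cmd :=
  .seq solveC (.seq badC (.seq (countC 5 6 (eqE (.read 6 (.reg 5)) (.const 0)))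
    (.ite (.reg 2) .skip (.ite (.reg 6) .skip (.assign 1 (.const 1))))))

theorem decides_goodC : Decides n A goodC (Good n A) := by
  classical
  intro σ hσ
  refine ⟨hσ.run rfl rfl rfl, run_view rfl σ, ?_⟩
  set σ1 := solveC.run n σ with hσ1
  set σ2 := badC.run n σ1 with hσ2
  set σ3 := (countC 5 6 (eqE (.read 6 (.reg 5)) (.const 0))).run n σ2 with hσ3
  have i1 : Inv n A σ1 := hσ.run rfl rfl rfl
  have r1 : σ3.reg 1 = σ.reg 1 := by
    rw [hσ3, run_reg rfl, hσ2, run_reg rfl, hσ1, run_reg rfl]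
  have hb : σ3.reg 2 ≠ 0 ↔ Bad n A (solve n A (view n 5 σ)) := by
    rw [hσ3, run_reg rfl, hσ2, reg_badC i1, hσ1, view_solveC hσ]
  have hc : σ3.reg 6 = ((Finset.range n).filter
      (fun v => solve n A (view n 5 σ) v = 0)).card := by
    refine run_countC (w := 5) (c := 6) (by decide) fun i hi τ ha hr hw => ?_
    rw [eval_eqE, ← view_solveC hσ, view_of_lt _ hi]
    simp only [Exp.eval, hw, ha]
    rw [hσ2, run_arr rfl]
  have hz : σ3.reg 6 = 0 ↔ ∀ v < n, solve n A (view n 5 σ) v ≠ 0 := by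
    rw [hc, Finset.card_eq_zero, Finset.filter_eq_empty_iff]
    simp
  simp only [goodC, Cmd.run, Exp.eval, ← hσ1, ← hσ2, ← hσ3, Good, ← hb, ← hz]
  by_cases h2 : σ3.reg 2 = 0 <;> by_cases h6 : σ3.reg 6 = 0 <;>
    simp [h2, h6, r1, setReg_reg_self]

/-- Run `p` with the colour `a` for the vertex in register `r`. -/
def withC (r a : ℕ) (p : Cmd) : Cmd :=
  .seq (.assign (r + 1) (.read 5 (.reg r))) (.seq (.write 5 (.reg r) (.const a))
    (.seq p (.write 5 (.reg r) (.reg (r + 1)))))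

open Classical in
theorem run_withC {p : Cmd} {Q : (ℕ → ℕ) → Prop} (hp : Decides n A p Q) {r : ℕ} (hr : 2 ≤ r)
    (h1 : p.keepsReg r = true) (h2 : p.keepsReg (r + 1) = true) (a : ℕ) {σ : State}
    (hσ : Inv n A σ) (hv : σ.reg r < n) :
    Inv n A ((withC r a p).run n σ) ∧ view n 5 ((withC r a p).run n σ) = view n 5 σ ∧
      ((withC r a p).run n σ).reg r = σ.reg r ∧
      ((withC r a p).run n σ).reg 1 =
        if Q (Function.update (view n 5 σ) (σ.reg r) a) then 1 else σ.reg 1 := by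
  have hrr : r ≠ r + 1 := by omega
  set σ1 := σ.setReg (r + 1) (σ.arr 5 (σ.reg r)) with hσ1
  have q1 : σ1.reg r = σ.reg r := setReg_reg_of_ne _ _ hrr
  have q1' : σ1.reg (r + 1) = σ.arr 5 (σ.reg r) := setReg_reg_self _ _ _
  set σ2 := σ1.setArr 5 (σ.reg r) a with hσ2
  have i2 : Inv n A σ2 := (hσ.setReg (r := r + 1) (by omega) (σ.arr 5 (σ.reg r))).of_eq rfl rfl rfl
  have v2 : view n 5 σ2 = Function.update (view n 5 σ) (σ.reg r) a := view_setArr σ1 a hv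
  obtain ⟨i3, v3, a3⟩ := hp σ2 i2
  set σ3 := p.run n σ2 with hσ3
  have q3 : σ3.reg r = σ.reg r := (run_reg h1 σ2).trans q1
  have q3' : σ3.reg (r + 1) = σ.arr 5 (σ.reg r) := (run_reg h2 σ2).trans q1'
  have hrun : (withC r a p).run n σ = σ3.setArr 5 (σ.reg r) (σ.arr 5 (σ.reg r)) := by
    simp only [withC, Cmd.run, Exp.eval, ← hσ1, q1, ← hσ2, ← hσ3, q3, q3']
  rw [hrun]
  refine ⟨i3.of_eq rfl rfl rfl, ?_, q3, ?_⟩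
  · rw [view_setArr _ _ hv, v3, v2, Function.update_idem, ← view_of_lt σ hv,
      Function.update_eq_self]
  · change σ3.reg 1 = _
    rw [a3, v2]
    have : σ2.reg 1 = σ.reg 1 := setReg_reg_of_ne _ _ (by omega)
    rw [this]

/-- The nesting depth is the constant `k`, which keeps the time polynomial. Level `k` owns registers
`20 + 2 * k` (the guessed vertex) and `21 + 2 * k` (its saved entry), untouched by deeper levels. -/
def guessC : ℕ → Cmd
  | 0 => goodC
  | k + 1 => .seq (guessC k) (.forN (20 + 2 * k) (.seq (withC (20 + 2 * k) 1 (guessC k))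
      (.seq (withC (20 + 2 * k) 2 (guessC k)) (withC (20 + 2 * k) 3 (guessC k)))))

theorem guessC_keepsReg {r : ℕ} (k : ℕ) (hr : 20 + 2 * k ≤ r) : (guessC k).keepsReg r = true := by
  induction k with
  | zero =>
    simp [guessC, goodC, solveC, badC, tryC, placeC, propC, propStepC, seesC, copyC, countC,
      keepsReg]
    omega
  | succ k ih =>
    have := ih (by omega)
    simp [guessC, withC, keepsReg, this]
    omega

theorem guessC_wf (k : ℕ) : (guessC k).wf = true := by
  induction k with
  | zero => rfl
  | succ k ih =>
    simp [guessC, withC, keepsReg, wf, ih, guessC_keepsReg k]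

open Classical in
theorem loopN_ite (Q : ℕ → Prop) (n a : ℕ) :
    loopN (fun i b => if Q i then 1 else b) n a = if ∃ i < n, Q i then 1 else a := by
  induction n with
  | zero => simp [loopN]
  | succ n ih =>
    rw [loopN, ih]
    have : (∃ i < n + 1, Q i) ↔ Q n ∨ ∃ i < n, Q i := by
      simp only [Nat.lt_succ_iff_lt_or_eq, or_and_right, exists_or, exists_eq_left]
      exact or_comm
    simp only [this]
    split_ifs <;> grind

theorem decides_guessC (k : ℕ) : Decides n A (guessC k) (GoodAfter n A k) := by
  classical
  induction k with
  | zero => exact decides_goodC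
  | succ k ih =>
    intro σ hσ
    obtain ⟨i1, v1, a1⟩ := ih σ hσ
    set σ1 := (guessC k).run n σ with hσ1
    set r := 20 + 2 * k with hr
    have kr : (guessC k).keepsReg r = true := guessC_keepsReg k le_rfl
    have kr' : (guessC k).keepsReg (r + 1) = true := guessC_keepsReg k (by omega)
    obtain ⟨Q, hQ⟩ : ∃ Q : ℕ → Prop, ∀ v, Q v ↔
        (GoodAfter n A k (Function.update (view n 5 σ) v 1) ∨
          GoodAfter n A k (Function.update (view n 5 σ) v 2) ∨
          GoodAfter n A k (Function.update (view n 5 σ) v 3)) := ⟨_, fun _ => Iff.rfl⟩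
    have hloop := run_forN (n := n) (r := r) (p := .seq (withC r 1 (guessC k))
      (.seq (withC r 2 (guessC k)) (withC r 3 (guessC k)))) (fun σ => σ.reg 1)
      (fun τ => Inv n A τ ∧ view n 5 τ = view n 5 σ)
      (fun v b => if Q v then 1 else b)
      (fun τ i h => ⟨h.1.setReg (by omega) i, h.2⟩)
      (fun τ i => setReg_reg_of_ne _ _ (by omega)) (by
        rintro v hv τ ⟨hτ, hτv⟩ rfl
        have hr2 : 2 ≤ r := by omega
        obtain ⟨i2, v2, q2, a2⟩ := run_withC ih hr2 kr kr' 1 hτ hv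
        obtain ⟨i3, v3, q3, a3⟩ := run_withC ih hr2 kr kr' 2 i2 (q2.symm ▸ hv)
        obtain ⟨i4, v4, q4, a4⟩ := run_withC ih hr2 kr kr' 3 i3 (q3.symm ▸ q2.symm ▸ hv)
        rw [Cmd.run, Cmd.run]
        refine ⟨⟨i4, by rw [v4, v3, v2, hτv]⟩, ?_⟩
        rw [a4, a3, a2, q3, q2, v3, v2, hτv]
        simp only [hQ]
        split_ifs <;> grind) (σ := σ1) ⟨i1, v1⟩
    rw [loopN_ite] at hloop
    rw [guessC, Cmd.run, ← hσ1]
    refine ⟨hloop.1.1, hloop.1.2, hloop.2.trans ?_⟩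
    rw [a1]
    simp only [GoodAfter, ← hQ]
    split_ifs <;> grind

/-! ## The core -/

def coreStepC : Cmd :=
  .seq (countC 5 6 (andE (adjE 4 5) (eqE (.read 5 (.reg 5)) (.const 0))))
    (.ite (.read 5 (.reg 4)) .skip
      (.ite (.sub (.const 3) (.reg 6)) (.write 5 (.reg 4) (.const 4)) .skip))

theorem view_coreStepC {σ : State} (hσ : Inv n A σ) {v : ℕ} (hv : v < n) (h4 : σ.reg 4 = v) :
    view n 5 (coreStepC.run n σ) = coreStep n A v (view n 5 σ) := by
  classical
  subst h4
  set σ1 := (countC 5 6 (andE (adjE 4 5) (eqE (.read 5 (.reg 5)) (.const 0)))).run n σ with hσ1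
  have q1 : σ1.reg 4 = σ.reg 4 := run_reg rfl σ
  have b1 : σ1.arr 5 = σ.arr 5 := run_arr rfl σ
  have hc : σ1.reg 6 = ((Finset.range n).filter
      (fun w => A (σ.reg 4) w ∧ view n 5 σ w = 0)).card := by
    refine run_countC (w := 5) (c := 6) (by decide) fun i hi τ ha hr hw => ?_
    have h4 : τ.reg 4 = σ.reg 4 := hr 4 (by omega) (by omega)
    have hτ : Inv n A τ := hσ.of_eq (hr 0 (by omega) (by omega)) (by rw [ha]) (by rw [ha])
    apply eval_andE
    · rw [hτ.eval_adjE (u := 4) (v := 5) (by omega) (by omega), h4, hw]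
    · rw [eval_eqE, view_of_lt σ hi]
      simp only [Exp.eval, hw, ha]
  have hif : 3 - σ1.reg 6 = 0 ↔ ¬ σ1.reg 6 < 3 := by omega
  have hset : view n 5 (σ1.setArr 5 (σ.reg 4) 4) = Function.update (view n 5 σ) (σ.reg 4) 4 := by
    rw [view_setArr _ _ hv, view_congr b1]
  unfold coreStep
  rw [view_of_lt σ hv]
  have hc' : ((Finset.range n).filter (fun w => A (σ.reg 4) w ∧ view n 5 σ w = 0)).card < 3 ↔
      σ1.reg 6 < 3 := by rw [hc]
  simp only [coreStepC, Cmd.run, Exp.eval, ← hσ1, q1, b1, hif, ne_eq]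
  by_cases h0 : σ.arr 5 (σ.reg 4) = 0 <;> by_cases h3 : σ1.reg 6 < 3
  · rw [if_neg (by simpa using h0), if_pos (by simpa using h3), hset, if_pos]
    exact ⟨h0, hc'.2 h3⟩
  · rw [if_neg (by simpa using h0), if_neg (by simpa using h3), view_congr b1, if_neg]
    exact fun h => h3 (hc'.1 h.2)
  all_goals
    rw [if_pos (by simpa using h0), view_congr b1, if_neg]
    exact fun h => h0 h.1

def coreC : Cmd := .forN 10 (.forN 4 coreStepC)

theorem view_coreC {σ : State} (hσ : Inv n A σ) (h0 : view n 5 σ = fun _ => 0) :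
    view n 5 (coreC.run n σ) = core n A := by
  have := (run_forN (n := n) (r := 10) (p := .forN 4 coreStepC) (view n 5) (Inv n A)
    (fun _ => loopN (coreStep n A) n)
    (fun σ i h => h.setReg (by omega) i) (fun _ _ => rfl) (fun _ _ τ hτ _ =>
      run_forN (view n 5) (Inv n A) (coreStep n A)
        (fun σ i h => h.setReg (by omega) i) (fun _ _ => rfl)
        (fun v hv ρ hρ h4 => ⟨hρ.run rfl rfl rfl, view_coreStepC hρ hv h4⟩) hτ) hσ).2
  rwa [h0] at this

/-- Store the beginnings of the rows of the matrix in array `3`. -/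
def rowsC : Cmd :=
  .seq (.assign 3 (.const 0))
    (.forN 4 (.seq (.write 3 (.reg 4) (.reg 3)) (.assign 3 (.add (.reg 3) (.reg 0)))))

/-- The machine cannot multiply, so register `3` accumulates the multiples of `n` by addition. -/
theorem arr_rowsC {σ : State} (h0 : σ.reg 0 = n) :
    ∀ u < n, (rowsC.run n σ).arr 3 u = u * n := by
  have key := loopN_induct
    (fun i τ => (Cmd.seq (.write 3 (.reg 4) (.reg 3))
      (.assign 3 (.add (.reg 3) (.reg 0)))).run n (τ.setReg 4 i)) n (σ.setReg 3 0)
    (fun i τ => τ.reg 0 = n ∧ τ.reg 3 = i * n ∧ ∀ u < i, τ.arr 3 u = u * n)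
    ⟨h0, by simp [setReg_reg_self], by simp⟩ (by
      rintro i hi τ ⟨h1, h2, h3⟩
      refine ⟨by simpa [Cmd.run, State.setReg, State.setArr] using h1, ?_, fun u hu => ?_⟩
      · simp [Cmd.run, Exp.eval, State.setReg, State.setArr, h1, h2, Nat.succ_mul]
      · by_cases hui : u = i
        · subst hui
          simp [Cmd.run, Exp.eval, State.setReg, State.setArr, h2]
        · simpa [Cmd.run, Exp.eval, State.setReg, State.setArr, Function.update_of_ne hui] using
            h3 u (by omega))
  exact key.2.2

def mainC (k : ℕ) : Cmd := .seq rowsC (.seq coreC (guessC k))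

theorem mainC_wf (k : ℕ) : (mainC k).wf = true := by
  rw [mainC, wf, wf, guessC_wf]; rfl

end ThreeCol

/-! ### Correctness of the program on input graphs -/

namespace PartitionedGraph

/-- The adjacency relation on the numbers of the vertices. -/
def Rel (x : PartitionedGraph) (u v : ℕ) : Prop :=
  ∃ (hu : u < x.n) (hv : v < x.n), x.graph.Adj ⟨u, hu⟩ ⟨v, hv⟩

theorem Rel.symm {x : PartitionedGraph} {u v : ℕ} (h : x.Rel u v) : x.Rel v u := by
  obtain ⟨hu, hv, h⟩ := h
  exact ⟨hv, hu, h.symm⟩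

theorem not_rel_self (x : PartitionedGraph) (v : ℕ) : ¬ x.Rel v v := by
  rintro ⟨hu, hv, h⟩
  exact h.ne rfl

end PartitionedGraph

namespace ThreeCol

open RAM Cmd

open Classical in
theorem reg_mainC (x : PartitionedGraph) (k : ℕ) :
    ((mainC k).run x.n x.input).reg 1 =
      if GoodAfter x.n x.Rel k (core x.n x.Rel) then 1 else 0 := by
  have h0 : x.input.reg 0 = x.n := rfl
  have i1 : Inv x.n x.Rel (rowsC.run x.n x.input) := by
    refine ⟨(run_reg rfl _).trans h0, fun u hu v hv => ?_, arr_rowsC h0⟩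
    rw [run_arr rfl]
    simp only [PartitionedGraph.input, if_true]
    have : (∃ u' v' : Fin x.n, u * x.n + v = u'.val * x.n + v'.val ∧ x.graph.Adj u' v') ↔
        x.Rel u v := by
      constructor
      · rintro ⟨u', v', heq, hadj⟩
        -- Row-major indexing is injective: division by `n` recovers the row, because both columns
        -- are below `n`.
        have hpos : 0 < x.n := by omega
        have e1 : u = u' := by
          have := congrArg (· / x.n) heq
          simpa [Nat.add_comm _ v, Nat.add_comm _ v'.val, Nat.add_mul_div_right _ _ hpos,
            Nat.div_eq_of_lt hv, Nat.div_eq_of_lt v'.2] using this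
        subst e1
        have e2 : v = v' := by omega
        subst e2
        exact ⟨hu, hv, hadj⟩
      · rintro ⟨hu, hv, hadj⟩
        exact ⟨⟨u, hu⟩, ⟨v, hv⟩, rfl, hadj⟩
    simp only [this, ind]
  have v1 : view x.n 5 (rowsC.run x.n x.input) = fun _ => 0 := by
    rw [run_view rfl]
    funext i
    simp [view, PartitionedGraph.input]
  have i2 : Inv x.n x.Rel (coreC.run x.n (rowsC.run x.n x.input)) := i1.run rfl rfl rfl
  rw [mainC, Cmd.run, Cmd.run, (decides_guessC k _ i2).2.2, view_coreC i1 v1, run_reg rfl,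
    run_reg rfl]
  rfl

theorem colorable_of_goodAfter {x : PartitionedGraph} {k : ℕ}
    (h : GoodAfter x.n x.Rel k (core x.n x.Rel)) : x.graph.Colorable 3 := by
  obtain ⟨f, hf, hp⟩ := Live.of_core (n := x.n) (A := x.Rel)
    (fun _ _ => PartitionedGraph.Rel.symm) x.not_rel_self h.live
  refine ⟨SimpleGraph.Coloring.mk (fun v => ⟨f v - 1, by have := hf v v.2 rfl; omega⟩) ?_⟩
  intro u v huv heq
  rw [Fin.mk.injEq] at heq
  have h1 := hf u u.2 rfl
  have h2 := hf v v.2 rfl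
  exact hp u u.2 v v.2 rfl rfl ⟨u.2, v.2, huv⟩ (by omega)

/-- The right guess is a dominating set of the core, coloured as in a given 3-colouring; that
colouring itself witnesses extendibility. -/
theorem goodAfter_of_colorable {s : ℕ} {x : PartitionedGraph}
    (hx : IsPartitionedProbeFree (pathThreePlusIsolated s) x.graph x.P x.N)
    (h : x.graph.Colorable 3) : GoodAfter x.n x.Rel (7 * s + 4) (core x.n x.Rel) := by
  classical
  obtain ⟨c⟩ := h
  have hsymm : ∀ u v, x.Rel u v → x.Rel v u := fun _ _ => PartitionedGraph.Rel.symm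
  set g := core x.n x.Rel with hg
  let C : Finset (Fin x.n) := Finset.univ.filter (fun v => g v = 0)
  have hC : ∀ v ∈ C, 3 ≤ (C.filter (x.graph.Adj v)).card := by
    intro v hv
    have hv0 : g v = 0 := by simpa [C] using hv
    refine (core_degree v.2 hv0).trans ?_
    rw [← Finset.card_map Fin.valEmbedding (s := C.filter (x.graph.Adj v))]
    refine Finset.card_le_card fun w hw => ?_
    simp only [Finset.mem_filter, Finset.mem_range] at hw
    obtain ⟨hwn, ⟨_, _, hadj⟩, hw0⟩ := hw
    exact Finset.mem_map.2 ⟨⟨w, hwn⟩, by simp [C, hadj, hg, hw0], rfl⟩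
  obtain ⟨D, hDC, hDcard, hdom⟩ := exists_dominating hx c C hC
  -- The shift by one keeps `0` free for uncoloured vertices; the value beyond `n` only makes `hf`
  -- hold everywhere.
  let f : ℕ → ℕ := fun v => if hv : v < x.n then (c ⟨v, hv⟩ : ℕ) + 1 else 1
  have hf : ∀ v, 1 ≤ f v ∧ f v ≤ 3 := by
    intro v
    simp only [f]
    split_ifs <;> omega
  have hfp : ∀ u v, x.Rel u v → f u ≠ f v := by
    rintro u v ⟨hu, hv, hadj⟩ heq
    simp only [f, hu, hv, dif_pos] at heq
    exact c.valid hadj (Fin.ext (by omega))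
  have hmem : ∀ v : Fin x.n, (v : ℕ) ∈ D.map Fin.valEmbedding ↔ v ∈ D := fun v =>
    Finset.mem_map' Fin.valEmbedding
  have hD0 : ∀ v ∈ D.map Fin.valEmbedding, g v = 0 := by
    intro v hv
    obtain ⟨w, hw, rfl⟩ := Finset.mem_map.1 hv
    simpa [C] using hDC hw
  refine GoodAfter.of_finset (D := D.map Fin.valEmbedding) (h := f) (fun v hv => ?_)
    (by rwa [Finset.card_map]) (fun v _ => hf v) (good_of_ext hsymm ?_ ?_)
  · obtain ⟨w, _, rfl⟩ := Finset.mem_map.1 hv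
    exact w.2
  · intro y hy hy0
    by_cases hyD : y ∈ D.map Fin.valEmbedding
    · simp only [if_pos hyD] at hy0
      have := hf y
      omega
    · simp only [if_neg hyD] at hy0
      rcases hdom ⟨y, hy⟩ (by simpa [C] using hy0) with h | ⟨w, hw, hadj⟩
      · exact absurd ((hmem ⟨y, hy⟩).2 h) hyD
      · refine ⟨w, w.2, ⟨hy, w.2, hadj⟩, ?_⟩
        simp only [if_pos ((hmem w).2 hw)]
        exact hf w
  -- An extension must repeat the mark `4` of deleted vertices, which takes part in no conflict.
  · refine ⟨fun v => if g v = 4 then 4 else f v, ?_, fun v hv => ?_⟩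
    · rintro ⟨u, hu, v, hv, huv, heq, h1, h3⟩
      have := hfp u v huv
      beta_reduce at heq h1 h3
      split_ifs at heq h1 h3 <;> omega
    · have hg04 := core_eq (n := x.n) (A := x.Rel) v
      rw [← hg] at hg04
      have hfv := hf v
      by_cases hvD : v ∈ D.map Fin.valEmbedding
      · simp only [hvD, if_true, hD0 v hvD]
        refine ⟨fun _ => by simp, fun h => by omega⟩
      · simp only [hvD, if_false]
        rcases hg04 with h | h
        · simp [h, hfv]
        · simp [h]

end ThreeCol

open ThreeCol RAM in
/-- For every fixed `s ≥ 0`, 3-Colouring is polynomial-time solvable on partitioned probe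
`(P₃ + sP₁)`-free graphs. -/
theorem mainTheorem4 (s : ℕ) :
    PolyTimeSolvableOn
      (fun x => IsPartitionedProbeFree (pathThreePlusIsolated s) x.graph x.P x.N)
      (fun x => x.graph.Colorable 3) := by
  classical
  -- Register `0` holds `n` for all loops, so the answer is moved there only at the end, in two more
  -- steps.
  refine ⟨.seq (mainC (7 * s + 4)).compile (.assign 0 (.reg 1)),
    (mainC (7 * s + 4)).time + 2, fun x hx => ?_⟩
  obtain ⟨t, ht, htle⟩ := Cmd.runs_compile (n := x.n) (mainC_wf (7 * s + 4)) x.input rfl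
  refine ⟨_, _, .seq ht (.assign 0 (.reg 1) _), ?_, fun h => ?_, fun h => ?_⟩
  · simp only [Exp.cost, Polynomial.eval_add, Polynomial.eval_ofNat]
    omega
  · rw [setReg_reg_self, Exp.eval, reg_mainC, if_pos (goodAfter_of_colorable hx h)]
  · rw [setReg_reg_self, Exp.eval, reg_mainC, if_neg fun hgood => h (colorable_of_goodAfter hgood)]
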